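/- Let $N_R\ge 1$ and let $\lambda,\rho_0,\rho>0$, $\alpha>2$. A receiver with $N_R$ antennas is located at the origin of $\mathbb{R}^2$, its transmitter at a fixed point $x_0\ne 0$, $R_0=\|x_0\|$. The interferers form a stationary Poisson point process $\Phi=\{x_i\}_{i\ge1}\subset\mathbb{R}^2$ of intensity $\lambda$, indexed so that $X_i=\|x_i\|$ is nondecreasing in $i$. The channels $\mathbf h_j\in\mathbb{C}^{N_R}$ ($j\ge 0$; $\mathbf h_0$ belongs to the transmitter, $\mathbf h_i$ to the interferer $x_i$) are i.i.d. $\mathcal{CN}(0,\mathbf I)$ and independent of $\Phi$. For $0\le M\le N_R-1$ let $\mathbf H=(\mathbf h_1\,\cdots\,\mathbf h_M)$, let $\mathbf H^\sharp$ be its Moore–Penrose pseudoinverse, and put $$\mathbf v=\frac{(\mathbf I-\mathbf H\mathbf H^\sharp)\mathbf h_0}{\|(\mathbf I-\mathbf H\mathbf H^\sharp)\mathbf h_0\|},\qquad S_j(M)=|\mathbf v^{\mathrm H}\mathbf h_j|^2,\qquad I(M)=\rho\sum_{i=M+1}^\infty X_i^{-\alpha}S_i(M),\qquad \mathsf{SIR}(M)=\frac{\rho_0R_0^{-\alpha}S_0(M)}{I(M)}.$$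 Then, for every $0\le M\le N_R-1$, almost surely the series $I(M)$ converges and $I(M)>0$, and the function $$\mathcal L_{I(M)}(s)=\mathbb E_\Phi\Big[\prod_{i=M+1}^\infty\frac1{1+s\rho X_i^{-\alpha}}\Big],\qquad s\ge 0,$$ is well defined (for each $s\ge 0$ the product converges almost surely and is integrable), is the Laplace transform of the interference, $\mathcal L_{I(M)}(s)=\mathbb E[e^{-sI(M)}]$, and is infinitely differentiable on $(0,\infty)$. For every $\theta>0$ the success probability $\mathsf P_{\rm suc}(\theta,M)=\Pr[\mathsf{SIR}(M)>\theta]$ is $$\mathsf P_{\rm suc}(\theta,M)=\sum_{n=0}^{N_R-M-1}\left[\frac{(-s)^n}{n!}\,\frac{\mathrm d^n}{\mathrm ds^n}\mathcal L_{I(M)}(s)\right]_{s=\theta\rho_0^{-1}R_0^\alpha}.$$ For $M=0$ the Laplace transform has the closed form, for all $s\ge0$, $$\mathcal L_{I(0)}(s)=\exp\left(-2\pi^2\lambda\,\frac{(s\rho)^{2/\alpha}}{\alpha}\,\csc\left(\frac{2\pi}{\alpha}\right)\right).$$ -/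

import Mathlib

open MeasureTheory ProbabilityTheory
open scoped Matrix

/-- The Euclidean plane, in which the nodes are located. -/
abbrev Plane : Type := EuclideanSpace ℝ (Fin 2)

/-! ### Poisson point processes -/

/-- Number of points (with multiplicity) of the configuration `x` that lie in `B`. -/
noncomputable def pointCount (x : ℕ → Plane) (B : Set Plane) : ℕ∞ :=
  Set.encard {i | x i ∈ B}

/-- The random points `x 0, x 1, …` form a stationary Poisson point process of intensity `lam` on
the plane: the number of points in a Borel set of finite area `a` is Poisson with mean `lam * a`,
and the numbers of points in disjoint Borel sets are independent. -/
structure IsPoissonPointProcess {Ω : Type*} [MeasurableSpace Ω] (P : Measure Ω)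
    (x : ℕ → Ω → Plane) (lam : ℝ) : Prop where
  measurable : ∀ i, Measurable (x i)
  poisson : ∀ B : Set Plane, MeasurableSet B → volume B ≠ ⊤ → ∀ k : ℕ,
    P.real {ω | pointCount (fun i => x i ω) B = k} =
      Real.exp (-(lam * volume.real B)) * (lam * volume.real B) ^ k / (k.factorial : ℝ)
  indep : ∀ (m : ℕ) (B : Fin m → Set Plane), (∀ j, MeasurableSet (B j)) →
    (∀ i j, i ≠ j → Disjoint (B i) (B j)) →
    iIndepFun (fun (j : Fin m) (ω : Ω) => pointCount (fun i => x i ω) (B j)) P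

/-! ### Rayleigh fading -/

/-- The circularly symmetric complex Gaussian distribution `𝒞𝒩(0, 1)` on `ℂ`: independent real and
imaginary parts, each centred normal with variance `1/2`. -/
noncomputable def stdComplexGaussian : Measure ℂ :=
  ((gaussianReal 0 (1 / 2)).prod (gaussianReal 0 (1 / 2))).map (fun p : ℝ × ℝ => (⟨p.1, p.2⟩ : ℂ))

/-- The distribution `𝒞𝒩(0, I)` on `ℂ^N`: independent `𝒞𝒩(0, 1)` coordinates. -/
noncomputable def stdComplexGaussianVec (N : ℕ) : Measure (EuclideanSpace ℂ (Fin N)) :=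
  (Measure.pi (fun _ : Fin N => stdComplexGaussian)).map (WithLp.toLp 2)

/-! ### The pseudoinverse -/

/-- The four Penrose conditions. -/
structure IsMoorePenrose {m n : ℕ} (A : Matrix (Fin m) (Fin n) ℂ)
    (B : Matrix (Fin n) (Fin m) ℂ) : Prop where
  mul_mul_left : A * B * A = A
  mul_mul_right : B * A * B = B
  isHermitian_left : (A * B).IsHermitian
  isHermitian_right : (B * A).IsHermitian

/-- The Moore–Penrose pseudoinverse `A♯ = f(Aᴴ A) Aᴴ`, where `f(t) = 1/t` for `t ≠ 0` and
`f(0) = 0`; see `isMoorePenrose_pinv` and `IsMoorePenrose.unique`. -/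
noncomputable def pinv {m n : ℕ} (A : Matrix (Fin m) (Fin n) ℂ) : Matrix (Fin n) (Fin m) ℂ :=
  cfc (fun t : ℝ => t⁻¹) (Aᴴ * A) * Aᴴ

open scoped ComplexOrder in
theorem isMoorePenrose_pinv {m n : ℕ} (A : Matrix (Fin m) (Fin n) ℂ) :
    IsMoorePenrose A (pinv A) := by
  set Q : Matrix (Fin n) (Fin n) ℂ := Aᴴ * A with hQ
  have hQs : IsSelfAdjoint Q := Matrix.isHermitian_conjTranspose_mul_self A
  have hfin : (spectrum ℝ Q).Finite := Matrix.finite_real_spectrum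
  have hc : ∀ f : ℝ → ℝ, ContinuousOn f (spectrum ℝ Q) := fun f => hfin.continuousOn f
  set G : Matrix (Fin n) (Fin n) ℂ := cfc (fun t : ℝ => t⁻¹) Q with hG
  have hGs : Gᴴ = G := (cfc_predicate (fun t : ℝ => t⁻¹) Q : IsSelfAdjoint G)
  have hid : cfc (fun t : ℝ => t) Q = Q := cfc_id' ℝ Q
  have hGQ : G * Q = cfc (fun t : ℝ => t⁻¹ * t) Q := by
    rw [cfc_mul _ _ Q (hc _) (hc _), hid]
  have hQG : Q * G = cfc (fun t : ℝ => t⁻¹ * t) Q := by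
    have h1 := congrArg Matrix.conjTranspose hGQ
    rw [Matrix.conjTranspose_mul, hGs, show Qᴴ = Q from hQs] at h1
    rw [h1]
    exact (cfc_predicate (fun t : ℝ => t⁻¹ * t) Q : IsSelfAdjoint _)
  have hQGQ : Q * (G * Q) = Q := by
    rw [hGQ]
    conv_lhs => rw [← hid]
    rw [hid]
    nth_rewrite 1 [← hid]
    rw [← cfc_mul _ _ Q (hc _) (hc _)]
    nth_rewrite 2 [← hid]
    congr 1; ext t
    by_cases ht : t = 0 <;> simp [ht]
  have hGQG : G * Q * G = G := by
    rw [hGQ, hG, ← cfc_mul _ _ Q (hc _) (hc _)]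
    congr 1; ext t
    by_cases ht : t = 0 <;> simp [ht]
  have hAGQ : A * (G * Q) = A := by
    rw [← sub_eq_zero, ← Matrix.conjTranspose_mul_self_eq_zero]
    have h1 : A * (G * Q) - A = A * (G * Q - 1) := by rw [Matrix.mul_sub, Matrix.mul_one]
    have h2 : Q * (G * Q - 1) = 0 := by rw [Matrix.mul_sub, Matrix.mul_one, hQGQ, sub_self]
    rw [h1, Matrix.conjTranspose_mul, Matrix.mul_assoc, ← Matrix.mul_assoc Aᴴ, ← hQ, h2,
      Matrix.mul_zero]
  have hB : pinv A = G * Aᴴ := rfl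
  refine ⟨?_, ?_, ?_, ?_⟩
  · rw [hB, Matrix.mul_assoc, Matrix.mul_assoc, ← hQ, hAGQ]
  · rw [hB, Matrix.mul_assoc G, ← hQ, ← Matrix.mul_assoc, hGQG]
  · rw [hB, Matrix.IsHermitian, Matrix.conjTranspose_mul, Matrix.conjTranspose_mul, hGs,
      Matrix.conjTranspose_conjTranspose, Matrix.mul_assoc]
  · rw [hB, Matrix.mul_assoc, ← hQ, hGQ]
    exact (cfc_predicate (fun t : ℝ => t⁻¹ * t) Q : IsSelfAdjoint _)

theorem IsMoorePenrose.unique {m n : ℕ} {A : Matrix (Fin m) (Fin n) ℂ}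
    {B C : Matrix (Fin n) (Fin m) ℂ} (hB : IsMoorePenrose A B) (hC : IsMoorePenrose A C) :
    B = C := by
  have h1 : A * B = A * C := by
    have h : (A * B) * (A * C) = A * C := by rw [← Matrix.mul_assoc, hB.mul_mul_left]
    have h' := congrArg Matrix.conjTranspose h
    rw [Matrix.conjTranspose_mul, hB.isHermitian_left, hC.isHermitian_left,
      ← Matrix.mul_assoc, hC.mul_mul_left] at h'
    exact h'
  have h2 : B * A = C * A := by
    have h : (C * A) * (B * A) = C * A := by
      rw [Matrix.mul_assoc, ← Matrix.mul_assoc A, hB.mul_mul_left]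
    have h' := congrArg Matrix.conjTranspose h
    rw [Matrix.conjTranspose_mul, hB.isHermitian_right, hC.isHermitian_right,
      Matrix.mul_assoc, ← Matrix.mul_assoc A, hC.mul_mul_left] at h'
    exact h'
  rw [← hB.mul_mul_right, Matrix.mul_assoc, h1, ← Matrix.mul_assoc, h2, hC.mul_mul_right]

/-! ### Partial zero-forcing

In the following definitions `h 0` is the channel vector of the associated transmitter, `x i`
(`i = 0, 1, …`) is the location of the `(i + 1)`-th interferer and `h (i + 1)` is its channel
vector. -/

/-- The `N × M` matrix whose columns are the channels of the first `M` interferers. -/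
def channelMatrix {N : ℕ} (h : ℕ → EuclideanSpace ℂ (Fin N)) (M : ℕ) :
    Matrix (Fin N) (Fin M) ℂ :=
  Matrix.of fun a j => h (j + 1) a

/-- `(I - H H♯) h₀`, with `H` the channel matrix of the first `M` interferers. -/
noncomputable def projectedChannel {N : ℕ} (h : ℕ → EuclideanSpace ℂ (Fin N)) (M : ℕ) :
    EuclideanSpace ℂ (Fin N) :=
  WithLp.toLp 2 ((1 - channelMatrix h M * pinv (channelMatrix h M)) *ᵥ (h 0).ofLp)

/-- The receive combining vector `(I - H H♯) h₀ / ‖(I - H H♯) h₀‖`. -/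
noncomputable def combiner {N : ℕ} (h : ℕ → EuclideanSpace ℂ (Fin N)) (M : ℕ) :
    EuclideanSpace ℂ (Fin N) :=
  ((‖projectedChannel h M‖⁻¹ : ℝ) : ℂ) • projectedChannel h M

/-- The effective gain `S_j(M) = |vᴴ h_j|²`. -/
noncomputable def gain {N : ℕ} (h : ℕ → EuclideanSpace ℂ (Fin N)) (M j : ℕ) : ℝ :=
  ‖star (combiner h M).ofLp ⬝ᵥ (h j).ofLp‖ ^ 2

/-- The contribution `ρ X_i^{-α} S_i(M)` to the interference of the interferer of index
`i = M + k + 1`. -/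
noncomputable def interferenceTerm {N : ℕ} (ρ α : ℝ) (x : ℕ → Plane)
    (h : ℕ → EuclideanSpace ℂ (Fin N)) (M k : ℕ) : ℝ :=
  ρ * ‖x (M + k)‖ ^ (-α) * gain h M (M + k + 1)

/-- The overall interference `I(M)`. -/
noncomputable def interference {N : ℕ} (ρ α : ℝ) (x : ℕ → Plane)
    (h : ℕ → EuclideanSpace ℂ (Fin N)) (M : ℕ) : ℝ :=
  ∑' k : ℕ, interferenceTerm ρ α x h M k

/-- The signal-to-interference ratio `ρ₀ R₀^{-α} S₀(M) / I(M)`, with `R₀ = ‖x₀‖`. -/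
noncomputable def sir {N : ℕ} (ρ₀ ρ α : ℝ) (x₀ : Plane) (x : ℕ → Plane)
    (h : ℕ → EuclideanSpace ℂ (Fin N)) (M : ℕ) : ℝ :=
  ρ₀ * ‖x₀‖ ^ (-α) * gain h M 0 / interference ρ α x h M

/-- The factor `1 / (1 + s ρ X_i^{-α})` of the interferer of index `i = M + k + 1`. -/
noncomputable def laplaceFactor (ρ α : ℝ) (x : ℕ → Plane) (M : ℕ) (s : ℝ) (k : ℕ) : ℝ :=
  1 / (1 + s * ρ * ‖x (M + k)‖ ^ (-α))

/-- The function `s ↦ E_Φ[∏_{i > M} 1 / (1 + s ρ X_i^{-α})]`. -/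
noncomputable def laplaceI {Ω : Type*} [MeasurableSpace Ω] (P : Measure Ω) (ρ α : ℝ)
    (x : ℕ → Ω → Plane) (M : ℕ) (s : ℝ) : ℝ :=
  ∫ ω, ∏' k : ℕ, laplaceFactor ρ α (fun i => x i ω) M s k ∂P

/-- The success probability `Pr[SIR(M) > θ]`. -/
noncomputable def successProb {Ω : Type*} [MeasurableSpace Ω] {N : ℕ} (P : Measure Ω)
    (ρ₀ ρ α : ℝ) (x₀ : Plane) (x : ℕ → Ω → Plane) (h : ℕ → Ω → EuclideanSpace ℂ (Fin N))
    (θ : ℝ) (M : ℕ) : ℝ :=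
  P.real {ω | θ < sir ρ₀ ρ α x₀ (fun i => x i ω) (fun j => h j ω) M}

/-!
Zero-forcing replaces the channel of the transmitter by its component orthogonal to the `M`
cancelled channels, by the Penrose conditions (`projectedChannel_eq_orthoResidual`). A standard
complex Gaussian vector has standard complex Gaussian coordinates along every orthonormal family
(`map_inner_stdComplexGaussianVec`), and the cancelled channels are almost surely linearly
independent (`ae_linearIndependent`). Conditionally on them, `S₀` is therefore the squared norm of a
standard complex Gaussian vector of dimension `N - M`, so that it has the Gamma distribution of shape
`N - M`. Conditionally on the channel of the transmitter as well, the `S_i` of the remaining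
interferers are squared components along a fixed unit vector, so that they are i.i.d. exponential.
None of these conditional distributions depends on the conditions: `S₀`, the sequence of the `S_i`
and the locations are independent (`measurePreserving_locations_gains`).

Integrating out the exponential gains gives the product `∏ 1 / (1 + s ρ X_i ^ (-α))`, hence
`laplaceI` is the Laplace transform of the interference `I`
(`integral_exp_neg_interferenceSeries`). It is smooth, and its `n`-th derivative is
`E[(-I) ^ n exp (-s I)]`. The event `SIR > θ` is `S₀ > s I` with `s = θ ρ₀⁻¹ R₀ ^ α`, and the tail
of a Gamma distribution of integer shape is a partial exponential series
(`gammaMeasure_real_Ioi`), so that the success probability is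
`∑ E[(s I) ^ n exp (-s I)] / n!` over `n < N - M`: these are the derivatives of `laplaceI`
(`measureReal_mul_lt_of_gammaMeasure`).

Convergence of the interference comes from Campbell's formula (`IsPoissonPointProcess.sum_map`,
`IsPoissonPointProcess.ae_summable`). For `M = 0` the product runs over all points of the process,
and its mean is given by the Laplace functional `E[exp (-∑ g (x_i))] = exp (-lam ∫ (1 - exp (-g)))`
(`IsPoissonPointProcess.integral_exp_neg_tsum`) at `g (y) = log (1 + s ρ ‖y‖ ^ (-α))`. The integral
reduces in polar coordinates to a product of two Gamma integrals, which the reflection formula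
evaluates (`integral_pathLoss`).
-/

/-! ### Gamma distributions with integer shape -/

/-- The exponent `b` is complex with positive real part, so that one computation serves both the
tail (`b = 1`) and the characteristic function (`b = 1 - i t`) of the Gamma distribution. -/
lemma integrableOn_pow_mul_cexp {b : ℂ} (hb : 0 < b.re) (n : ℕ) {t : ℝ} (ht : 0 ≤ t) :
    IntegrableOn (fun x : ℝ => (x : ℂ) ^ n * Complex.exp (-(b * x))) (Set.Ioi t) := by
  have h := integrableOn_rpow_mul_exp_neg_mul_rpow (p := 1) (s := n) (b := b.re)
    (by have := n.cast_nonneg (α := ℝ); linarith) one_pos hb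
  refine IntegrableOn.mono_set ?_ (Set.Ioi_subset_Ioi ht)
  refine Integrable.mono' h (by fun_prop) ?_
  filter_upwards [ae_restrict_mem measurableSet_Ioi] with x hx
  rw [norm_mul, norm_pow, Complex.norm_real, Complex.norm_exp, Real.norm_of_nonneg (le_of_lt hx)]
  simp

lemma tendsto_pow_mul_cexp {b : ℂ} (hb : 0 < b.re) (n : ℕ) :
    Filter.Tendsto (fun x : ℝ => (x : ℂ) ^ n * Complex.exp (-(b * x))) Filter.atTop (nhds 0) := by
  rw [tendsto_zero_iff_norm_tendsto_zero]
  have h := tendsto_rpow_mul_exp_neg_mul_atTop_nhds_zero n b.re hb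
  refine h.congr' ?_
  filter_upwards [Filter.eventually_ge_atTop 0] with x hx
  rw [norm_mul, norm_pow, Complex.norm_real, Complex.norm_exp, Real.norm_of_nonneg hx]
  simp

lemma integral_cexp_neg_mul_Ioi {b : ℂ} (hb : 0 < b.re) {t : ℝ} (ht : 0 ≤ t) :
    ∫ x in Set.Ioi t, Complex.exp (-(b * (x : ℝ))) = Complex.exp (-(b * t)) / b := by
  have hb0 : b ≠ 0 := by rintro rfl; simp at hb
  have hd : ∀ x ∈ Set.Ici t, HasDerivAt (fun x : ℝ => -(Complex.exp (-(b * x)) / b))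
      (Complex.exp (-(b * x))) x := by
    intro x _
    have h1 : HasDerivAt (fun x : ℝ => -(b * (x : ℂ))) (-(b * 1)) x :=
      (Complex.ofRealCLM.hasDerivAt.const_mul b).neg
    have h2 := (h1.cexp.div_const b).neg
    convert! h2 using 1
    field_simp
  have h := integral_Ioi_of_hasDerivAt_of_tendsto' hd
    (by simpa using integrableOn_pow_mul_cexp hb 0 ht)
    (m := 0) (by simpa using ((tendsto_pow_mul_cexp hb 0).div_const b).neg)
  simpa using h

/-- Integration by parts for the incomplete Gamma integrals with integer exponent. -/
lemma integral_pow_succ_mul_cexp_neg_mul_Ioi {b : ℂ} (hb : 0 < b.re) (n : ℕ) {t : ℝ}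
    (ht : 0 ≤ t) :
    ∫ x in Set.Ioi t, ((x : ℝ) : ℂ) ^ (n + 1) * Complex.exp (-(b * x)) =
      (t : ℂ) ^ (n + 1) * Complex.exp (-(b * t)) / b +
        (n + 1) / b * ∫ x in Set.Ioi t, ((x : ℝ) : ℂ) ^ n * Complex.exp (-(b * x)) := by
  have hb0 : b ≠ 0 := by rintro rfl; simp at hb
  have hd : ∀ x ∈ Set.Ici t,
      HasDerivAt (fun x : ℝ => -((x : ℂ) ^ (n + 1) * Complex.exp (-(b * x)) / b))
      ((x : ℂ) ^ (n + 1) * Complex.exp (-(b * x)) -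
        (n + 1) / b * ((x : ℂ) ^ n * Complex.exp (-(b * x)))) x := by
    intro x _
    have h1 : HasDerivAt (fun x : ℝ => -(b * (x : ℂ))) (-(b * 1)) x :=
      (Complex.ofRealCLM.hasDerivAt.const_mul b).neg
    have h3 : HasDerivAt (fun x : ℝ => (x : ℂ) ^ (n + 1)) _ x :=
      (Complex.ofRealCLM.hasDerivAt (x := x)).pow (n + 1)
    have h2 := ((h3.mul h1.cexp).div_const b).neg
    convert! h2 using 1
    simp
    field_simp
    ring
  have hi1 := integrableOn_pow_mul_cexp hb (n + 1) ht
  have hi2 := (integrableOn_pow_mul_cexp hb n ht).const_mul ((n + 1) / b)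
  have h := integral_Ioi_of_hasDerivAt_of_tendsto' hd (hi1.sub hi2)
    (m := 0) (by simpa using ((tendsto_pow_mul_cexp hb (n + 1)).div_const b).neg)
  rw [integral_sub hi1 hi2, integral_const_mul] at h
  linear_combination h

lemma integral_pow_mul_cexp_neg_mul_Ioi_zero {b : ℂ} (hb : 0 < b.re) (n : ℕ) :
    ∫ x in Set.Ioi (0 : ℝ), ((x : ℝ) : ℂ) ^ n * Complex.exp (-(b * x)) =
      n.factorial / b ^ (n + 1) := by
  induction n with
  | zero => simpa using integral_cexp_neg_mul_Ioi hb le_rfl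
  | succ n ih =>
    rw [integral_pow_succ_mul_cexp_neg_mul_Ioi hb n le_rfl, ih, Nat.factorial_succ]
    have hb0 : b ≠ 0 := by rintro rfl; simp at hb
    push_cast
    field_simp
    simp only [ne_eq, Nat.add_eq_zero_iff, one_ne_zero, and_false, not_false_eq_true, zero_pow,
      zero_mul, zero_add]
    ring

lemma integral_pow_mul_exp_neg_Ioi (n : ℕ) {t : ℝ} (ht : 0 ≤ t) :
    ∫ x in Set.Ioi t, x ^ n * Real.exp (-x) =
      n.factorial * ∑ k ∈ Finset.range (n + 1), t ^ k / k.factorial * Real.exp (-t) := by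
  have key : ∫ x in Set.Ioi t, ((x : ℝ) : ℂ) ^ n * Complex.exp (-((1 : ℂ) * x)) =
      n.factorial * ∑ k ∈ Finset.range (n + 1),
        (t : ℂ) ^ k / k.factorial * Complex.exp (-t) := by
    induction n with
    | zero => simpa using integral_cexp_neg_mul_Ioi (b := 1) (by simp) ht
    | succ n ih =>
      rw [integral_pow_succ_mul_cexp_neg_mul_Ioi (by simp) n ht, ih,
        Finset.sum_range_succ _ (n + 1), Nat.factorial_succ]
      have : (n.factorial : ℂ) ≠ 0 := by exact_mod_cast n.factorial_ne_zero
      have : (n + 1 : ℂ) ≠ 0 := by exact_mod_cast n.succ_ne_zero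
      push_cast
      field_simp
      ring_nf
  apply Complex.ofReal_injective
  rw [← integral_complex_ofReal]
  push_cast
  simpa using key

lemma gammaPDFReal_natSucc {n : ℕ} {x : ℝ} (hx : 0 ≤ x) :
    gammaPDFReal (n + 1 : ℕ) 1 x = (n.factorial : ℝ)⁻¹ * (x ^ n * Real.exp (-x)) := by
  simp only [gammaPDFReal, if_pos hx, Nat.cast_succ, Real.Gamma_nat_eq_factorial,
    add_sub_cancel_right, Real.rpow_natCast, Real.one_rpow, one_mul]
  ring

lemma integral_gammaMeasure {E : Type*} [NormedAddCommGroup E] [NormedSpace ℝ E] (n : ℕ)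
    (f : ℝ → E) :
    ∫ x, f x ∂(gammaMeasure (n + 1 : ℕ) 1) =
      ∫ x in Set.Ioi (0 : ℝ), ((n.factorial : ℝ)⁻¹ * (x ^ n * Real.exp (-x))) • f x := by
  have hm : Measurable (gammaPDF (n + 1 : ℕ) 1) := (measurable_gammaPDFReal _ _).ennreal_ofReal
  rw [gammaMeasure, integral_withDensity_eq_integral_toReal_smul hm
    (by simp [gammaPDF]), ← integral_Ici_eq_integral_Ioi,
    ← integral_indicator measurableSet_Ici]
  refine integral_congr_ae (Filter.Eventually.of_forall fun x => ?_)
  have hp : (0 : ℝ) < (n + 1 : ℕ) := by positivity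
  by_cases hx : 0 ≤ x
  · rw [Set.indicator_of_mem (show x ∈ Set.Ici 0 from hx)]
    simp only [gammaPDF]
    rw [ENNReal.toReal_ofReal (gammaPDFReal_nonneg hp one_pos x), gammaPDFReal_natSucc hx]
  · rw [Set.indicator_of_notMem (by simpa using hx)]
    simp only
    rw [gammaPDF_of_neg (by simpa using hx)]
    simp

instance isProbabilityMeasure_gammaMeasure_natSucc (n : ℕ) :
    IsProbabilityMeasure (gammaMeasure (n + 1 : ℕ) 1) :=
  isProbabilityMeasure_gammaMeasure (by positivity) one_pos

instance isProbabilityMeasure_expMeasure_one : IsProbabilityMeasure (expMeasure 1) :=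
  isProbabilityMeasure_expMeasure one_pos

lemma charFun_gammaMeasure (n : ℕ) (t : ℝ) :
    charFun (gammaMeasure (n + 1 : ℕ) 1) t = (1 - t * Complex.I)⁻¹ ^ (n + 1) := by
  have hb : 0 < (1 - t * Complex.I).re := by simp
  have hn : (n.factorial : ℂ) ≠ 0 := by exact_mod_cast n.factorial_ne_zero
  rw [charFun_apply_real, integral_gammaMeasure, inv_pow]
  have h := integral_pow_mul_cexp_neg_mul_Ioi_zero hb n
  calc _ = ∫ x in Set.Ioi (0 : ℝ), (n.factorial : ℂ)⁻¹ *
        ((x : ℂ) ^ n * Complex.exp (-((1 - t * Complex.I) * x))) := by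
        refine integral_congr_ae (Filter.Eventually.of_forall fun x => ?_)
        simp only [Complex.real_smul]
        push_cast
        rw [mul_assoc, mul_assoc, ← Complex.exp_add]
        ring_nf
    _ = _ := by
        rw [integral_const_mul, h]
        field_simp

/-- The tail of the Gamma distribution of integer shape is a partial exponential series. -/
lemma gammaMeasure_real_Ioi (n : ℕ) {t : ℝ} (ht : 0 ≤ t) :
    (gammaMeasure (n + 1 : ℕ) 1).real (Set.Ioi t) =
      ∑ k ∈ Finset.range (n + 1), t ^ k / k.factorial * Real.exp (-t) := by
  have hn : (n.factorial : ℝ) ≠ 0 := by exact_mod_cast n.factorial_ne_zero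
  rw [← integral_indicator_one measurableSet_Ioi, integral_gammaMeasure]
  have h1 : ∀ x : ℝ, ((n.factorial : ℝ)⁻¹ * (x ^ n * Real.exp (-x))) •
      (Set.Ioi t).indicator (1 : ℝ → ℝ) x =
      (Set.Ioi t).indicator (fun x => (n.factorial : ℝ)⁻¹ * (x ^ n * Real.exp (-x))) x := by
    intro x
    by_cases hx : x ∈ Set.Ioi t <;> simp [hx]
  simp_rw [h1]
  rw [setIntegral_indicator measurableSet_Ioi,
    Set.inter_eq_right.mpr (Set.Ioi_subset_Ioi ht), integral_const_mul,
    integral_pow_mul_exp_neg_Ioi n ht, inv_mul_cancel_left₀ hn]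

lemma expMeasure_one_eq : expMeasure 1 = gammaMeasure (0 + 1 : ℕ) 1 := by
  simp [expMeasure]

/-- The Laplace transform of the exponential distribution. -/
lemma integral_exp_neg_mul_expMeasure {c : ℝ} (hc : 0 ≤ c) :
    ∫ x, Real.exp (-(c * x)) ∂(expMeasure 1) = 1 / (1 + c) := by
  rw [expMeasure_one_eq, integral_gammaMeasure]
  simp only [Nat.factorial_zero, Nat.cast_one, inv_one, pow_zero, one_mul, smul_eq_mul]
  have h := integral_exp_mul_Ioi (a := -(1 + c)) (by linarith) 0
  rw [mul_zero, Real.exp_zero, neg_div_neg_eq] at h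
  rw [← h]
  congr 1; ext x
  rw [← Real.exp_add]; ring_nf

lemma ae_pos_expMeasure : ∀ᵐ x ∂(expMeasure 1), 0 < x := by
  have h := gammaMeasure_real_Ioi 0 le_rfl
  rw [← expMeasure_one_eq] at h
  have h1 : (expMeasure 1).real (Set.Ioi 0)ᶜ = 0 := by
    rw [probReal_compl_eq_one_sub measurableSet_Ioi, h]; simp
  rwa [measureReal_eq_zero_iff] at h1

lemma integrable_id_expMeasure : Integrable (fun x : ℝ => x) (expMeasure 1) := by
  have hm : Measurable (gammaPDF 1 1) := (measurable_gammaPDFReal _ _).ennreal_ofReal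
  rw [expMeasure, gammaMeasure, integrable_withDensity_iff_integrable_smul' hm (by simp [gammaPDF])]
  have h := integrableOn_rpow_mul_exp_neg_mul_rpow (p := 1) (s := 1) (b := 1)
    (by norm_num) one_pos one_pos
  rw [← integrableOn_Ici_iff_integrableOn_Ioi] at h
  refine (h.integrable_indicator measurableSet_Ici).congr
    (Filter.Eventually.of_forall fun x => ?_)
  by_cases hx : 0 ≤ x
  · rw [Set.indicator_of_mem (show x ∈ Set.Ici 0 from hx)]
    simp only [gammaPDF]
    rw [ENNReal.toReal_ofReal (gammaPDFReal_nonneg one_pos one_pos x)]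
    simp [gammaPDFReal, hx, mul_comm]
  · rw [Set.indicator_of_notMem (by simpa using hx)]
    simp only
    rw [gammaPDF_of_neg (by simpa using hx)]
    simp

/-! ### Circularly symmetric complex Gaussian vectors -/

lemma measurable_complex_mk : Measurable (fun p : ℝ × ℝ => (⟨p.1, p.2⟩ : ℂ)) :=
  Complex.measurableEquivRealProd.symm.measurable

instance isProbabilityMeasure_stdComplexGaussian : IsProbabilityMeasure stdComplexGaussian :=
  Measure.isProbabilityMeasure_map measurable_complex_mk.aemeasurable

instance isProbabilityMeasure_stdComplexGaussianVec (N : ℕ) :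
    IsProbabilityMeasure (stdComplexGaussianVec N) :=
  Measure.isProbabilityMeasure_map (WithLp.measurable_toLp 2 _).aemeasurable

lemma integral_stdComplexGaussian_mul (f g : ℝ → ℂ) (hf : Measurable f) (hg : Measurable g) :
    ∫ z, f z.re * g z.im ∂stdComplexGaussian =
      (∫ x, f x ∂(gaussianReal 0 (1 / 2))) * ∫ x, g x ∂(gaussianReal 0 (1 / 2)) := by
  rw [stdComplexGaussian, integral_map measurable_complex_mk.aemeasurable
    (by fun_prop), ← integral_prod_mul]

lemma charFun_stdComplexGaussian (t : ℂ) :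
    charFun stdComplexGaussian t = Complex.exp (-(‖t‖ ^ 2 / 4 : ℝ)) := by
  have h := integral_stdComplexGaussian_mul (fun x => Complex.exp (t.re * x * Complex.I))
    (fun x => Complex.exp (t.im * x * Complex.I)) (by fun_prop) (by fun_prop)
  rw [← charFun_apply_real, ← charFun_apply_real, charFun_gaussianReal, charFun_gaussianReal,
    ← Complex.exp_add] at h
  rw [charFun_apply]
  convert h using 2
  · ext z
    rw [← Complex.exp_add, Complex.inner]
    simp only [Complex.mul_re, Complex.conj_re, Complex.conj_im]
    push_cast
    ring_nf
  · rw [← Complex.normSq_eq_norm_sq, Complex.normSq_apply]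
    push_cast
    ring

lemma charFun_stdComplexGaussianVec {N : ℕ} (t : EuclideanSpace ℂ (Fin N)) :
    charFun (stdComplexGaussianVec N) t = Complex.exp (-(‖t‖ ^ 2 / 4 : ℝ)) := by
  rw [stdComplexGaussianVec, charFun_pi]
  simp_rw [charFun_stdComplexGaussian]
  rw [← Complex.exp_sum, EuclideanSpace.norm_sq_eq]
  push_cast
  rw [Finset.sum_neg_distrib, Finset.sum_div]

lemma real_inner_eq_re {N : ℕ} (x y : EuclideanSpace ℂ (Fin N)) :
    inner ℝ x y = (inner ℂ x y).re := by
  rw [PiLp.inner_apply, PiLp.inner_apply, Complex.re_sum]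
  rfl

/-- The coordinates of a standard complex Gaussian vector along an orthonormal family form a
standard complex Gaussian vector. -/
lemma map_inner_stdComplexGaussianVec {N d : ℕ} {b : Fin d → EuclideanSpace ℂ (Fin N)}
    (hb : Orthonormal ℂ b) :
    (stdComplexGaussianVec N).map (fun x => WithLp.toLp 2 fun j => inner ℂ (b j) x) =
      stdComplexGaussianVec d := by
  have hm : Measurable fun x : EuclideanSpace ℂ (Fin N) =>
      (WithLp.toLp 2 fun j => inner ℂ (b j) x : EuclideanSpace ℂ (Fin d)) := by
    refine (WithLp.measurable_toLp 2 _).comp (measurable_pi_lambda _ fun j => ?_)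
    fun_prop
  have : IsProbabilityMeasure ((stdComplexGaussianVec N).map
      (fun x => (WithLp.toLp 2 fun j => inner ℂ (b j) x : EuclideanSpace ℂ (Fin d)))) :=
    Measure.isProbabilityMeasure_map hm.aemeasurable
  refine Measure.ext_of_charFun (funext fun t => ?_)
  rw [charFun_stdComplexGaussianVec, charFun_apply, integral_map hm.aemeasurable (by fun_prop)]
  have hin : ∀ x, inner ℝ (WithLp.toLp 2 fun j => inner ℂ (b j) x : EuclideanSpace ℂ (Fin d)) t =
      inner ℝ x (∑ j, t j • b j) := by
    intro x
    rw [real_inner_eq_re, real_inner_eq_re, inner_sum, PiLp.inner_apply]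
    simp_rw [inner_smul_right, RCLike.inner_apply, inner_conj_symm]
  simp_rw [hin]
  rw [← charFun_apply, charFun_stdComplexGaussianVec]
  congr 4
  rw [EuclideanSpace.norm_sq_eq t]
  have h := hb.inner_sum t t Finset.univ
  rw [inner_self_eq_norm_sq_to_K] at h
  apply Complex.ofReal_injective
  push_cast
  simpa [Complex.conj_mul'] using h

/-- The characteristic function of `|z|²`, as a product of two equal Gaussian integrals, one for the
real and one for the imaginary part. -/
lemma charFun_normSq_stdComplexGaussian (s : ℝ) :
    ∫ z, Complex.exp (s * (‖z‖ ^ 2 : ℝ) * Complex.I) ∂stdComplexGaussian =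
      (1 - s * Complex.I)⁻¹ := by
  have hb : 0 < (1 - s * Complex.I).re := by simp
  have hb0 : (1 - s * Complex.I) ≠ 0 := by intro h; simp [h] at hb
  have h := integral_stdComplexGaussian_mul (fun x => Complex.exp (s * x ^ 2 * Complex.I))
    (fun x => Complex.exp (s * x ^ 2 * Complex.I)) (by fun_prop) (by fun_prop)
  have hg : ∫ x : ℝ, Complex.exp (s * x ^ 2 * Complex.I) ∂(gaussianReal 0 (1 / 2)) =
      (Real.sqrt Real.pi : ℂ)⁻¹ * (Real.pi / (1 - s * Complex.I)) ^ (1 / 2 : ℂ) := by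
    rw [integral_gaussianReal_eq_integral_smul (by simp), ← integral_gaussian_complex hb,
      ← integral_const_mul]
    congr 1; ext x
    simp only [gaussianPDFReal, Complex.real_smul]
    push_cast
    rw [mul_assoc, ← Complex.exp_add]
    congr 2
    · ring_nf
    · ring
  have hpi : (Real.sqrt Real.pi : ℂ) * Real.sqrt Real.pi = Real.pi := by
    rw [← Complex.ofReal_mul, Real.mul_self_sqrt Real.pi_pos.le]
  have hpi0 : (Real.pi : ℂ) ≠ 0 := by simp
  -- The two factors carry the same branch of the square root, so that its choice is immaterial.
  have hsq : ∀ w : ℂ, w ^ (1 / 2 : ℂ) * w ^ (1 / 2 : ℂ) = w := fun w => by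
    rw [← sq, one_div, Complex.cpow_ofNat_inv_pow]
  rw [hg, mul_mul_mul_comm, ← mul_inv, hpi, hsq] at h
  calc _ = _ := by
        refine integral_congr_ae (Filter.Eventually.of_forall fun z => ?_)
        simp only
        rw [← Complex.normSq_eq_norm_sq, Complex.normSq_apply]
        push_cast
        rw [← Complex.exp_add]
        ring_nf
    _ = _ := h.trans (by field_simp)

/-- The squared norm of a standard complex Gaussian vector in `ℂ^(n+1)` has the Gamma
distribution of shape `n + 1`. -/
lemma map_normSq_stdComplexGaussianVec (n : ℕ) :
    (stdComplexGaussianVec (n + 1)).map (fun x => ‖x‖ ^ 2) = gammaMeasure (n + 1 : ℕ) 1 := by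
  have hm : Measurable fun x : EuclideanSpace ℂ (Fin (n + 1)) => ‖x‖ ^ 2 := by fun_prop
  have : IsProbabilityMeasure ((stdComplexGaussianVec (n + 1)).map fun x => ‖x‖ ^ 2) :=
    Measure.isProbabilityMeasure_map hm.aemeasurable
  refine Measure.ext_of_charFun (funext fun s => ?_)
  rw [charFun_gammaMeasure, charFun_apply_real, integral_map hm.aemeasurable (by fun_prop),
    stdComplexGaussianVec, integral_map (WithLp.measurable_toLp 2 _).aemeasurable (by fun_prop)]
  simp_rw [EuclideanSpace.norm_sq_eq]
  push_cast
  simp_rw [Finset.mul_sum, Finset.sum_mul, Complex.exp_sum]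
  rw [integral_fintype_prod_eq_prod (fun _ (z : ℂ) => Complex.exp (s * ‖z‖ ^ 2 * Complex.I))]
  have h := charFun_normSq_stdComplexGaussian s
  push_cast at h
  simp [h]

/-- The squared modulus of the component of a standard complex Gaussian vector along a unit
vector is exponentially distributed. -/
lemma map_normSq_inner_stdComplexGaussianVec {N : ℕ} {v : EuclideanSpace ℂ (Fin N)}
    (hv : ‖v‖ = 1) :
    (stdComplexGaussianVec N).map (fun x => ‖inner ℂ v x‖ ^ 2) = expMeasure 1 := by
  have hb : Orthonormal ℂ (fun _ : Fin 1 => v) :=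
    ⟨fun _ => hv, fun i j hij => (hij (Subsingleton.elim i j)).elim⟩
  have hm : Measurable fun x : EuclideanSpace ℂ (Fin N) =>
      (WithLp.toLp 2 fun _ => inner ℂ v x : EuclideanSpace ℂ (Fin 1)) := by
    refine (WithLp.measurable_toLp 2 _).comp (measurable_pi_lambda _ fun j => ?_)
    fun_prop
  rw [expMeasure_one_eq, ← map_normSq_stdComplexGaussianVec 0, ← map_inner_stdComplexGaussianVec hb,
    Measure.map_map (by fun_prop) hm]
  congr 1
  ext x
  simp [EuclideanSpace.norm_sq_eq]

/-! ### Zero-forcing as an orthogonal projection -/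

/-- The component of `p.2` orthogonal to the span of the vectors `p.1`. -/
noncomputable def orthoResidual {N M : ℕ}
    (p : (Fin M → EuclideanSpace ℂ (Fin N)) × EuclideanSpace ℂ (Fin N)) :
    EuclideanSpace ℂ (Fin N) :=
  (Submodule.span ℂ (Set.range p.1))ᗮ.starProjection p.2

lemma starProjection_orthogonal_eq {N : ℕ} {W : Submodule ℂ (EuclideanSpace ℂ (Fin N))}
    {u r : EuclideanSpace ℂ (Fin N)} (hr : r ∈ Wᗮ) (hu : u - r ∈ W) :
    Wᗮ.starProjection u = r :=
  Submodule.eq_starProjection_of_mem_orthogonal hr (W.le_orthogonal_orthogonal hu)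

/-- By the Penrose conditions `A A♯` is the orthogonal projection onto the column space of `A`: the
residual is orthogonal to the columns since `Aᴴ (1 - A A♯) = 0`, and the difference is a combination
of the columns. -/
lemma projectedChannel_eq_orthoResidual {N : ℕ} (h : ℕ → EuclideanSpace ℂ (Fin N)) (M : ℕ) :
    projectedChannel h M = orthoResidual (fun j : Fin M => h (j + 1), h 0) := by
  have hMP := isMoorePenrose_pinv (channelMatrix h M)
  set A := channelMatrix h M with hA
  set B := pinv A with hB
  refine (starProjection_orthogonal_eq ?_ ?_).symm
  · rw [Submodule.mem_orthogonal]
    intro u hu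
    induction hu using Submodule.span_induction with
    | mem u hu =>
      obtain ⟨j, rfl⟩ := hu
      have h1 : Aᴴ * (1 - A * B) = 0 := by
        have h2 := congrArg Matrix.conjTranspose hMP.mul_mul_left
        rw [Matrix.conjTranspose_mul, hMP.isHermitian_left] at h2
        rw [Matrix.mul_sub, h2, Matrix.mul_one, sub_self]
      have h3 : Aᴴ *ᵥ ((1 - A * B) *ᵥ (h 0).ofLp) = 0 := by
        rw [Matrix.mulVec_mulVec, h1, Matrix.zero_mulVec]
      have h4 := congrFun h3 j
      rw [EuclideanSpace.inner_eq_star_dotProduct, dotProduct_comm]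
      exact h4
    | zero => simp
    | add u v _ _ hu hv => rw [inner_add_left, hu, hv, add_zero]
    | smul c u _ hu => rw [inner_smul_left, hu, mul_zero]
  · have h1 : h 0 - projectedChannel h M = ∑ j : Fin M, (B *ᵥ (h 0).ofLp) j • h (j + 1) := by
      ext a
      have h2 : ((A * B) *ᵥ (h 0).ofLp) a = ∑ j : Fin M, A a j * (B *ᵥ (h 0).ofLp) j := by
        rw [← Matrix.mulVec_mulVec]; rfl
      simp only [projectedChannel, Matrix.sub_mulVec, Matrix.one_mulVec, PiLp.sub_apply,
        Pi.sub_apply, sub_sub_cancel, ← hA, ← hB, h2, WithLp.ofLp_sum, Finset.sum_apply,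
        PiLp.smul_apply, smul_eq_mul]
      exact Finset.sum_congr rfl fun j _ => mul_comm _ _
    rw [h1]
    exact Submodule.sum_mem _ fun j _ => Submodule.smul_mem _ _ (Submodule.subset_span ⟨j, rfl⟩)

lemma measurable_gramSchmidt {N : ℕ} (n : ℕ) :
    Measurable fun f : ℕ → EuclideanSpace ℂ (Fin N) => InnerProductSpace.gramSchmidt ℂ f n := by
  induction n using Nat.strong_induction_on with
  | _ n ih =>
    have heq : (fun f : ℕ → EuclideanSpace ℂ (Fin N) => InnerProductSpace.gramSchmidt ℂ f n) =
        fun f => f n - ∑ i ∈ Finset.Iio n, (inner ℂ (InnerProductSpace.gramSchmidt ℂ f i) (f n) /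
          ((‖InnerProductSpace.gramSchmidt ℂ f i‖ ^ 2 : ℝ) : ℂ)) •
            InnerProductSpace.gramSchmidt ℂ f i := by
      funext f
      rw [InnerProductSpace.gramSchmidt_def]
      simp_rw [Submodule.starProjection_singleton]
      rfl
    rw [heq]
    refine (measurable_pi_apply n).sub (Finset.measurable_sum _ fun i hi => ?_)
    have hi' := ih i (Finset.mem_Iio.mp hi)
    have hn : Measurable fun f : ℕ → EuclideanSpace ℂ (Fin N) => f n := measurable_pi_apply n
    fun_prop

/-- The projection is the last vector of a Gram–Schmidt process, which is a measurable function
of the vectors even where they are linearly dependent. -/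
lemma measurable_orthoResidual {N M : ℕ} : Measurable (orthoResidual (N := N) (M := M)) := by
  set f : (Fin M → EuclideanSpace ℂ (Fin N)) × EuclideanSpace ℂ (Fin N) →
    ℕ → EuclideanSpace ℂ (Fin N) := fun p j => if hj : j < M then p.1 ⟨j, hj⟩ else p.2 with hf
  have hfm : Measurable f := by
    refine measurable_pi_lambda _ fun j => ?_
    by_cases hj : j < M
    · simp only [hf, hj, dif_pos]; fun_prop
    · simp only [hf, hj, dif_neg, not_false_eq_true]; fun_prop
  convert (measurable_gramSchmidt M).comp hfm using 1
  ext1 p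
  have hspan : Submodule.span ℂ (Set.range p.1) =
      Submodule.span ℂ (InnerProductSpace.gramSchmidt ℂ (f p) '' Set.Iio M) := by
    rw [InnerProductSpace.span_gramSchmidt_Iio]
    congr 1
    ext u
    constructor
    · rintro ⟨j, rfl⟩
      exact ⟨j, j.2, by simp [hf]⟩
    · rintro ⟨j, hj, rfl⟩
      exact ⟨⟨j, hj⟩, by simp [hf, show j < M from hj]⟩
  have hlast : p.2 = f p M := by simp [hf]
  refine starProjection_orthogonal_eq ?_ ?_
  · rw [hspan, Submodule.mem_orthogonal]
    intro u hu
    induction hu using Submodule.span_induction with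
    | mem u hu =>
      obtain ⟨j, hj, rfl⟩ := hu
      exact InnerProductSpace.gramSchmidt_orthogonal ℂ _ (ne_of_lt hj)
    | zero => simp
    | add u v _ _ hu hv => rw [inner_add_left, hu, hv, add_zero]
    | smul c u _ hu => rw [inner_smul_left, hu, mul_zero]
  · rw [hspan, hlast, Function.comp_apply, InnerProductSpace.gramSchmidt_def, sub_sub_cancel]
    refine Submodule.sum_mem _ fun i hi => ?_
    rw [Submodule.starProjection_singleton]
    exact Submodule.smul_mem _ _ (Submodule.subset_span ⟨i, Finset.mem_Iio.mp hi, rfl⟩)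

/-- The squared modulus of the component of `u` along the direction of `r`; it is `0` for `r = 0`.
With `r` the residual channel of the transmitter this is the effective gain of the channel `u`. -/
noncomputable def residualGain {N : ℕ} (r u : EuclideanSpace ℂ (Fin N)) : ℝ :=
  ‖inner ℂ (((‖r‖⁻¹ : ℝ) : ℂ) • r) u‖ ^ 2

lemma measurable_residualGain {N : ℕ} {β : Type*} [MeasurableSpace β]
    {f g : β → EuclideanSpace ℂ (Fin N)} (hf : Measurable f) (hg : Measurable g) :
    Measurable fun a => residualGain (f a) (g a) := by
  unfold residualGain
  fun_prop

lemma gain_eq_residualGain {N : ℕ} (h : ℕ → EuclideanSpace ℂ (Fin N)) (M j : ℕ) :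
    gain h M j = residualGain (orthoResidual (fun j : Fin M => h (j + 1), h 0)) (h j) := by
  rw [gain, residualGain, combiner, projectedChannel_eq_orthoResidual,
    EuclideanSpace.inner_eq_star_dotProduct, dotProduct_comm]

/-- The gain of the transmitter needs no normalization; for a vanishing residual both sides are
`0`. -/
lemma gain_zero_eq {N : ℕ} (h : ℕ → EuclideanSpace ℂ (Fin N)) (M : ℕ) :
    gain h M 0 = ‖orthoResidual (fun j : Fin M => h (j + 1), h 0)‖ ^ 2 := by
  rw [gain_eq_residualGain, residualGain, orthoResidual, inner_smul_left]
  set W := (Submodule.span ℂ (Set.range fun j : Fin M => h (j + 1)))ᗮ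
  have h1 : inner ℂ (W.starProjection (h 0)) (h 0) = ((‖W.starProjection (h 0)‖ ^ 2 : ℝ) : ℂ) := by
    have h2 := W.inner_starProjection_left_eq_right (W.starProjection (h 0)) (h 0)
    rw [W.starProjection_eq_self_iff.mpr (W.starProjection_apply_mem _),
      inner_self_eq_norm_sq_to_K] at h2
    rw [h2]; simp
  rw [h1, norm_mul, Complex.norm_real, RCLike.norm_conj, Complex.norm_real, norm_inv, norm_norm,
    Real.norm_of_nonneg (by positivity)]
  congr 1
  change ‖W.starProjection (h 0)‖⁻¹ * ‖W.starProjection (h 0)‖ ^ 2 = ‖W.starProjection (h 0)‖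
  by_cases h0 : ‖W.starProjection (h 0)‖ = 0
  · rw [h0]; simp
  · field_simp

lemma measurable_orthoResidual_right {N M : ℕ} (f : Fin M → EuclideanSpace ℂ (Fin N)) :
    Measurable fun u : EuclideanSpace ℂ (Fin N) => orthoResidual (f, u) := by
  have h : Measurable (Prod.mk (β := EuclideanSpace ℂ (Fin N)) f) := measurable_prodMk_left
  exact Measurable.comp measurable_orthoResidual h

/-! ### The distribution of the gains -/

/-- The coordinates of the projection along an orthonormal basis of `Wᗮ` form a standard complex
Gaussian vector of dimension `N - dim W`. -/
lemma map_normSq_starProjection {N n : ℕ} {W : Submodule ℂ (EuclideanSpace ℂ (Fin N))}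
    (hW : Module.finrank ℂ W + (n + 1) = N) :
    (stdComplexGaussianVec N).map (fun x => ‖Wᗮ.starProjection x‖ ^ 2) =
      gammaMeasure (n + 1 : ℕ) 1 := by
  have hd : Module.finrank ℂ Wᗮ = n + 1 := by
    have := W.finrank_add_finrank_orthogonal
    rw [finrank_euclideanSpace_fin] at this
    omega
  let b := (stdOrthonormalBasis ℂ Wᗮ).reindex (finCongr hd)
  have hb : Orthonormal ℂ fun j => (b j : EuclideanSpace ℂ (Fin N)) :=
    b.orthonormal.comp_linearIsometry Wᗮ.subtypeₗᵢ
  have hm : Measurable fun x : EuclideanSpace ℂ (Fin N) =>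
      (WithLp.toLp 2 fun j => inner ℂ (b j : EuclideanSpace ℂ (Fin N)) x :
        EuclideanSpace ℂ (Fin (n + 1))) := by
    refine (WithLp.measurable_toLp 2 _).comp (measurable_pi_lambda _ fun j => ?_)
    fun_prop
  rw [← map_normSq_stdComplexGaussianVec, ← map_inner_stdComplexGaussianVec hb,
    Measure.map_map (by fun_prop) hm]
  congr 1
  ext x
  rw [Function.comp_apply, Submodule.starProjection_apply, Submodule.norm_coe,
    ← b.sum_sq_norm_inner_right, EuclideanSpace.norm_sq_eq]
  simp

lemma ae_pos_gammaMeasure (n : ℕ) : ∀ᵐ x ∂(gammaMeasure (n + 1 : ℕ) 1), 0 < x := by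
  have h := gammaMeasure_real_Ioi n le_rfl
  have h1 : (gammaMeasure (n + 1 : ℕ) 1).real (Set.Ioi 0)ᶜ = 0 := by
    rw [probReal_compl_eq_one_sub measurableSet_Ioi, h, Finset.sum_range_succ']; simp
  rwa [measureReal_eq_zero_iff] at h1

lemma ae_starProjection_ne_zero {N : ℕ} {W : Submodule ℂ (EuclideanSpace ℂ (Fin N))}
    (hW : Module.finrank ℂ W < N) :
    ∀ᵐ x ∂(stdComplexGaussianVec N), Wᗮ.starProjection x ≠ 0 := by
  obtain ⟨n, hn⟩ := Nat.exists_eq_add_of_lt hW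
  have h := ae_pos_gammaMeasure n
  rw [← map_normSq_starProjection (W := W) (by omega)] at h
  filter_upwards [ae_of_ae_map (by fun_prop) h] with x hx h0
  simp [h0] at hx

/-- Fewer than `N + 1` independent standard complex Gaussian vectors in `ℂ^N` are almost surely
linearly independent: each one almost surely leaves the span of the others, which is a proper
subspace. -/
lemma ae_linearIndependent {N M : ℕ} (hM : M ≤ N) :
    ∀ᵐ f ∂(Measure.pi fun _ : Fin M => stdComplexGaussianVec N), LinearIndependent ℂ f := by
  induction M with
  | zero => exact Filter.Eventually.of_forall fun f => linearIndependent_empty_type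
  | succ M ih =>
    have hmp := measurePreserving_piFinSuccAbove
      (fun _ : Fin (M + 1) => stdComplexGaussianVec N) 0
    have hcons : Measurable fun p : (Fin M → EuclideanSpace ℂ (Fin N)) ×
        EuclideanSpace ℂ (Fin N) => (Fin.cons p.2 p.1 : Fin (M + 1) → EuclideanSpace ℂ (Fin N)) := by
      refine measurable_pi_lambda _ fun j => ?_
      refine Fin.cases ?_ (fun j => ?_) j
      · simp only [Fin.cons_zero]; fun_prop
      · simp only [Fin.cons_succ]; fun_prop
    have hs : MeasurableSet {p : (Fin M → EuclideanSpace ℂ (Fin N)) × EuclideanSpace ℂ (Fin N) |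
        LinearIndependent ℂ (Fin.cons p.2 p.1 : Fin (M + 1) → EuclideanSpace ℂ (Fin N))} :=
      hcons isOpen_setOfPred_linearIndependent.measurableSet
    have hae : ∀ᵐ p ∂((Measure.pi fun _ : Fin M => stdComplexGaussianVec N).prod
        (stdComplexGaussianVec N)),
        LinearIndependent ℂ (Fin.cons p.2 p.1 : Fin (M + 1) → EuclideanSpace ℂ (Fin N)) := by
      refine (Measure.ae_prod_mem_iff_ae_ae_mem hs).mpr ?_
      filter_upwards [ih (by omega)] with f hf
      have hrank := finrank_span_eq_card hf
      rw [Fintype.card_fin] at hrank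
      filter_upwards [ae_starProjection_ne_zero
        (W := Submodule.span ℂ (Set.range f)) (by omega)] with u hu
      rw [linearIndependent_finSucc]
      refine ⟨by simpa using hf, fun hmem => hu ?_⟩
      simp only [Fin.cons_zero, Fin.tail_cons] at hmem
      exact starProjection_orthogonal_eq (Submodule.zero_mem _) (by simpa using hmem)
    have hae' := (Measure.measurePreserving_swap.comp hmp).quasiMeasurePreserving.ae hae
    filter_upwards [hae'] with f hf
    convert hf using 1
    ext1 j
    refine Fin.cases ?_ (fun j => ?_) j <;> rfl

lemma comap_family_le_iSup {Ω ι κ β : Type*} [MeasurableSpace β] (f : ι → Ω → β) (c : κ → ι) :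
    MeasurableSpace.comap (fun ω k => f (c k) ω) MeasurableSpace.pi ≤
      ⨆ i ∈ Set.range c, MeasurableSpace.comap (f i) inferInstance := by
  rw [MeasurableSpace.pi, MeasurableSpace.comap_iSup]
  refine iSup_le fun k => ?_
  rw [MeasurableSpace.comap_comp]
  exact le_iSup₂_of_le (c k) ⟨k, rfl⟩ le_rfl

lemma indepFun_of_disjoint_range {Ω ι κ κ' β : Type*} {mΩ : MeasurableSpace Ω}
    {μ : Measure Ω} [MeasurableSpace β] {f : ι → Ω → β} (hf : iIndepFun f μ)
    (hm : ∀ i, Measurable (f i)) {a : κ → ι} {b : κ' → ι}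
    (hab : Disjoint (Set.range a) (Set.range b)) :
    IndepFun (fun ω k => f (a k) ω) (fun ω k => f (b k) ω) μ := by
  have h := indep_iSup_of_disjoint (fun i => (hm i).comap_le) hf.iIndep hab
  rw [IndepFun_iff_Indep]
  exact indep_of_indep_of_le_left (indep_of_indep_of_le_right h (comap_family_le_iSup f b))
    (comap_family_le_iSup f a)

section JointLaw

variable {Ω : Type*} [MeasurableSpace Ω] {P : Measure Ω} [IsProbabilityMeasure P] {N : ℕ}
  {h : ℕ → Ω → EuclideanSpace ℂ (Fin N)}

/-- The cancelled channels, the channel of the transmitter and the remaining channels are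
independent. -/
lemma map_channels (hmeas : ∀ j, Measurable (h j))
    (hlaw : ∀ j, P.map (h j) = stdComplexGaussianVec N) (hindep : iIndepFun h P) (M : ℕ) :
    P.map (fun ω => ((fun j : Fin M => h (j + 1) ω), h 0 ω, fun k : ℕ => h (M + k + 1) ω)) =
      (Measure.pi fun _ : Fin M => stdComplexGaussianVec N).prod
        ((stdComplexGaussianVec N).prod
          (Measure.infinitePi fun _ : ℕ => stdComplexGaussianVec N)) := by
  have h1 : IndepFun (fun ω (j : Fin M) => h (j + 1) ω)
      (fun ω (k : Option ℕ) => h (k.elim 0 fun k => M + k + 1) ω) P := by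
    refine indepFun_of_disjoint_range hindep hmeas (a := fun j : Fin M => (j : ℕ) + 1)
      (b := fun k : Option ℕ => k.elim 0 fun k => M + k + 1) ?_
    rw [Set.disjoint_left]
    rintro _ ⟨j, rfl⟩ ⟨k, hk⟩
    have := j.2
    cases k <;> simp at hk
    omega
  have h2 : IndepFun (fun ω (_ : Unit) => h 0 ω) (fun ω (k : ℕ) => h (M + k + 1) ω) P := by
    refine indepFun_of_disjoint_range hindep hmeas (a := fun _ : Unit => 0)
      (b := fun k : ℕ => M + k + 1) ?_
    rw [Set.disjoint_left]
    rintro _ ⟨j, rfl⟩ ⟨k, hk⟩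
    simp at hk
  have h1' : IndepFun (fun ω (j : Fin M) => h (j + 1) ω)
      (fun ω => (h 0 ω, fun k : ℕ => h (M + k + 1) ω)) P :=
    h1.comp measurable_id (ψ := fun f : Option ℕ → EuclideanSpace ℂ (Fin N) =>
      (f none, fun k => f (some k))) (by fun_prop)
  have h2' : IndepFun (h 0) (fun ω (k : ℕ) => h (M + k + 1) ω) P :=
    h2.comp (φ := fun f : Unit → EuclideanSpace ℂ (Fin N) => f ()) (by fun_prop) measurable_id
  rw [(indepFun_iff_map_prod_eq_prod_map_map (by fun_prop) (by fun_prop)).mp h1',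
    (indepFun_iff_map_prod_eq_prod_map_map (by fun_prop) (by fun_prop)).mp h2', hlaw 0]
  congr 2
  · have h3 : iIndepFun (fun j : Fin M => h (j + 1)) P :=
      hindep.precomp (g := fun j : Fin M => (j : ℕ) + 1) fun i j hij => by
        ext; simpa using hij
    rw [h3.map_fun_eq_pi_map (fun j => (hmeas _).aemeasurable)]
    simp_rw [hlaw]
  · have h3 : iIndepFun (fun k : ℕ => h (M + k + 1)) P :=
      hindep.precomp (g := fun k : ℕ => M + k + 1) fun i j hij => by
        simpa using hij
    rw [h3.map_fun_eq_infinitePi_map (fun j => hmeas _)]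
    simp_rw [hlaw]

lemma finrank_span_range_of_linearIndependent {M : ℕ} {f : Fin M → EuclideanSpace ℂ (Fin N)}
    (hf : LinearIndependent ℂ f) :
    Module.finrank ℂ (Submodule.span ℂ (Set.range f)) = M := by
  rw [finrank_span_eq_card hf, Fintype.card_fin]

lemma measurePreserving_normSq_orthoResidual {M n : ℕ} (hn : M + (n + 1) = N)
    {f : Fin M → EuclideanSpace ℂ (Fin N)} (hf : LinearIndependent ℂ f) :
    MeasurePreserving (fun u => ‖orthoResidual (f, u)‖ ^ 2) (stdComplexGaussianVec N)
      (gammaMeasure (n + 1 : ℕ) 1) := by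
  have hr := measurable_orthoResidual_right f
  have hrank := finrank_span_range_of_linearIndependent hf
  exact ⟨hr.norm.pow_const 2, map_normSq_starProjection (W := Submodule.span ℂ (Set.range f))
    (n := n) (by omega)⟩

/-- The gains of the interferers of channels `t`, given the cancelled channels `f` and the
channel `u` of the transmitter. -/
noncomputable def interfererGains {M : ℕ} (f : Fin M → EuclideanSpace ℂ (Fin N))
    (u : EuclideanSpace ℂ (Fin N)) (t : ℕ → EuclideanSpace ℂ (Fin N)) (k : ℕ) : ℝ :=
  residualGain (orthoResidual (f, u)) (t k)

lemma measurable_interfererGains {M : ℕ} (f : Fin M → EuclideanSpace ℂ (Fin N)) :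
    Measurable (Function.uncurry (interfererGains f)) := by
  have hr := measurable_orthoResidual_right f
  refine measurable_pi_lambda _ fun k => ?_
  exact measurable_residualGain (hr.comp measurable_fst)
    ((measurable_pi_apply k).comp measurable_snd)

lemma ae_map_interfererGains {M n : ℕ} (hn : M + (n + 1) = N)
    {f : Fin M → EuclideanSpace ℂ (Fin N)} (hf : LinearIndependent ℂ f) :
    ∀ᵐ u ∂(stdComplexGaussianVec N),
      (Measure.infinitePi fun _ : ℕ => stdComplexGaussianVec N).map
        (interfererGains f u) =
      Measure.infinitePi fun _ : ℕ => expMeasure 1 := by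
  have hrank := finrank_span_range_of_linearIndependent hf
  filter_upwards [ae_starProjection_ne_zero
    (W := Submodule.span ℂ (Set.range f)) (by omega)] with u hu
  unfold interfererGains
  rw [Measure.infinitePi_map_pi]
  · congr 1
    ext1 _
    refine map_normSq_inner_stdComplexGaussianVec ?_
    rw [norm_smul, Complex.norm_real, norm_inv, norm_norm]
    exact inv_mul_cancel₀ (norm_ne_zero_iff.mpr hu)
  · intro k
    exact measurable_residualGain measurable_const measurable_id

/-- Given linearly independent cancelled channels, the gain of the transmitter is Gamma
distributed, and it is independent of the gains of the interferers, which are i.i.d. exponential: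
these are the squared components of isotropic vectors along an independent unit vector. -/
lemma measurePreserving_gains_of_linearIndependent {M n : ℕ} (hn : M + (n + 1) = N)
    {f : Fin M → EuclideanSpace ℂ (Fin N)} (hf : LinearIndependent ℂ f) :
    MeasurePreserving (fun p : EuclideanSpace ℂ (Fin N) × (ℕ → EuclideanSpace ℂ (Fin N)) =>
        (‖orthoResidual (f, p.1)‖ ^ 2, interfererGains f p.1 p.2))
      ((stdComplexGaussianVec N).prod (Measure.infinitePi fun _ : ℕ => stdComplexGaussianVec N))
      ((gammaMeasure (n + 1 : ℕ) 1).prod (Measure.infinitePi fun _ : ℕ => expMeasure 1)) :=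
  (measurePreserving_normSq_orthoResidual hn hf).skew_product
    (measurable_interfererGains f) (ae_map_interfererGains hn hf)

/-- The joint distribution of the locations of the interferers, the gain of the transmitter and
the gains of the interferers that are not cancelled. -/
lemma measurePreserving_locations_gains {x : ℕ → Ω → Plane} (hx : ∀ i, Measurable (x i)) (hmeas : ∀ j, Measurable (h j))
    (hlaw : ∀ j, P.map (h j) = stdComplexGaussianVec N) (hindep : iIndepFun h P)
    (hxh : IndepFun (fun ω i => x i ω) (fun ω j => h j ω) P) {M n : ℕ} (hn : M + (n + 1) = N) :
    MeasurePreserving (fun ω => ((fun i => x i ω), gain (fun j => h j ω) M 0,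
        fun k => gain (fun j => h j ω) M (M + k + 1))) P
      ((P.map fun ω i => x i ω).prod ((gammaMeasure (n + 1 : ℕ) 1).prod
        (Measure.infinitePi fun _ : ℕ => expMeasure 1))) := by
  -- The gains are the function `G` of the channels, and `Q` is the distribution of the channels.
  set Q := (Measure.pi fun _ : Fin M => stdComplexGaussianVec N).prod
    ((stdComplexGaussianVec N).prod (Measure.infinitePi fun _ : ℕ => stdComplexGaussianVec N))
    with hQ
  set G := fun q : (Fin M → EuclideanSpace ℂ (Fin N)) × EuclideanSpace ℂ (Fin N) ×
      (ℕ → EuclideanSpace ℂ (Fin N)) => (‖orthoResidual (q.1, q.2.1)‖ ^ 2,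
        interfererGains q.1 q.2.1 q.2.2) with hG
  have hGm : Measurable G := by
    have hr : Measurable fun q : (Fin M → EuclideanSpace ℂ (Fin N)) × EuclideanSpace ℂ (Fin N) ×
        (ℕ → EuclideanSpace ℂ (Fin N)) => orthoResidual (q.1, q.2.1) :=
      Measurable.comp measurable_orthoResidual
        (measurable_fst.prodMk (measurable_fst.comp measurable_snd))
    refine Measurable.prodMk (hr.norm.pow_const 2) (measurable_pi_lambda _ fun k => ?_)
    exact measurable_residualGain hr
      ((measurable_pi_apply k).comp (measurable_snd.comp measurable_snd))
  have hGmp : MeasurePreserving G Q ((gammaMeasure (n + 1 : ℕ) 1).prod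
      (Measure.infinitePi fun _ : ℕ => expMeasure 1)) := by
    refine measurePreserving_snd.comp (μb := (Measure.pi fun _ : Fin M =>
      stdComplexGaussianVec N).prod _) (MeasurePreserving.skew_product (MeasurePreserving.id _)
        (g := fun f p => G (f, p)) hGm ?_)
    filter_upwards [ae_linearIndependent (N := N) (M := M) (by omega)] with f hf
    exact (measurePreserving_gains_of_linearIndependent hn hf).map_eq
  have hxm : Measurable fun ω i => x i ω := by fun_prop
  have hcm : Measurable fun ω => ((fun j : Fin M => h (j + 1) ω), h 0 ω,
      fun k : ℕ => h (M + k + 1) ω) := by fun_prop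
  have hind : IndepFun (fun ω i => x i ω) (fun ω => G ((fun j : Fin M => h (j + 1) ω), h 0 ω,
      fun k : ℕ => h (M + k + 1) ω)) P :=
    hxh.comp measurable_id (ψ := fun f : ℕ → EuclideanSpace ℂ (Fin N) =>
      G ((fun j : Fin M => f (j + 1)), f 0, fun k : ℕ => f (M + k + 1)))
      (hGm.comp (by fun_prop))
  have heq : (fun ω => ((fun i => x i ω), gain (fun j => h j ω) M 0,
        fun k => gain (fun j => h j ω) M (M + k + 1))) =
      fun ω => ((fun i => x i ω), G ((fun j : Fin M => h (j + 1) ω), h 0 ω,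
        fun k : ℕ => h (M + k + 1) ω)) := by
    ext1 ω
    rw [gain_zero_eq]
    simp_rw [gain_eq_residualGain]
    rfl
  rw [heq]
  have hGc : Measurable fun ω => G ((fun j : Fin M => h (j + 1) ω), h 0 ω,
      fun k : ℕ => h (M + k + 1) ω) := hGm.comp hcm
  refine ⟨hxm.prodMk hGc, ?_⟩
  rw [(indepFun_iff_map_prod_eq_prod_map_map hxm.aemeasurable
    hGc.aemeasurable).mp hind]
  congr 1
  rw [← hGmp.map_eq, hQ, ← map_channels hmeas hlaw hindep M, Measure.map_map hGm hcm]
  rfl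

end JointLaw

/-! ### The intensity measure of a Poisson point process -/

section PoissonProcess

variable {Ω : Type*} [MeasurableSpace Ω] {P : Measure Ω} [IsProbabilityMeasure P]
  {x : ℕ → Ω → Plane} {lam : ℝ}

lemma pointCount_toENNReal (y : ℕ → Plane) (B : Set Plane) :
    ((pointCount y B : ℕ∞) : ENNReal) = ∑' i, B.indicator 1 (y i) := by
  rw [pointCount, ← ENNReal.tsum_set_one, tsum_subtype {i | y i ∈ B} (fun _ => (1 : ENNReal))]
  rfl

lemma measurable_pointCount (hx : ∀ i, Measurable (x i)) {B : Set Plane} (hB : MeasurableSet B) :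
    Measurable fun ω => pointCount (fun i => x i ω) B := by
  have h : Measurable fun ω => ((pointCount (fun i => x i ω) B : ℕ∞) : ENNReal) := by
    simp_rw [pointCount_toENNReal]
    exact Measurable.tsum fun i => (measurable_one.indicator hB).comp (hx i)
  refine measurable_to_countable' fun n => ?_
  convert h (measurableSet_singleton (n : ENNReal)) using 1
  ext ω
  simp

/-- The mean number of points in a set of finite area, as a nonnegative real. -/
noncomputable def meanCount (lam : ℝ) (B : Set Plane) : NNReal := (lam * volume.real B).toNNReal

/-- The prescribed probabilities of finite counts add up to one, so that an infinite count has
probability zero. -/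
lemma IsPoissonPointProcess.map_pointCount (hΦ : IsPoissonPointProcess P x lam) (hlam : 0 ≤ lam)
    {B : Set Plane} (hB : MeasurableSet B) (hfin : volume B ≠ ⊤) :
    P.map (fun ω => pointCount (fun i => x i ω) B) =
      (poissonMeasure (meanCount lam B)).map (Nat.cast : ℕ → ℕ∞) := by
  have hm := measurable_pointCount hΦ.measurable hB
  have : IsProbabilityMeasure (P.map fun ω => pointCount (fun i => x i ω) B) :=
    Measure.isProbabilityMeasure_map hm.aemeasurable
  have hr : ((meanCount lam B : NNReal) : ℝ) = lam * volume.real B :=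
    Real.coe_toNNReal _ (by positivity)
  have hk : ∀ k : ℕ, P.map (fun ω => pointCount (fun i => x i ω) B) {(k : ℕ∞)} =
      (poissonMeasure (meanCount lam B)).map (Nat.cast : ℕ → ℕ∞) {(k : ℕ∞)} := by
    intro k
    rw [Measure.map_apply hm (measurableSet_singleton _),
      Measure.map_apply .of_discrete (measurableSet_singleton _)]
    have h1 : (Nat.cast : ℕ → ℕ∞) ⁻¹' {(k : ℕ∞)} = {k} := by ext; simp
    rw [h1, poissonMeasure_singleton, hr, ← hΦ.poisson B hB hfin k, ofReal_measureReal]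
    rfl
  refine Measure.ext_iff_singleton.mpr fun a => ?_
  induction a using ENat.recTopCoe with
  | coe k => exact hk k
  | top =>
    have hc : ({⊤} : Set ℕ∞) = (⋃ k : ℕ, {(k : ℕ∞)})ᶜ := by
      ext a
      induction a using ENat.recTopCoe <;> simp
    have hd : Pairwise (Function.onFun Disjoint fun k : ℕ => ({(k : ℕ∞)} : Set ℕ∞)) := by
      intro i j hij
      simpa using hij
    rw [hc, prob_compl_eq_one_sub (MeasurableSet.of_discrete),
      prob_compl_eq_one_sub (MeasurableSet.of_discrete),
      measure_iUnion hd (fun _ => MeasurableSet.of_discrete),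
      measure_iUnion hd (fun _ => MeasurableSet.of_discrete)]
    simp_rw [hk]

lemma IsPoissonPointProcess.ae_pointCount_ne_top (hΦ : IsPoissonPointProcess P x lam)
    (hlam : 0 ≤ lam) {B : Set Plane} (hB : MeasurableSet B) (hfin : volume B ≠ ⊤) :
    ∀ᵐ ω ∂P, pointCount (fun i => x i ω) B ≠ ⊤ := by
  have hm := measurable_pointCount hΦ.measurable hB
  refine ae_of_ae_map hm.aemeasurable (p := fun a => a ≠ ⊤) ?_
  rw [hΦ.map_pointCount hlam hB hfin, ae_map_iff .of_discrete .of_discrete]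
  simp

/-- The probability generating function of the Poisson distribution. -/
lemma integral_exp_poissonMeasure (r : NNReal) (c : ℝ) :
    ∫ n : ℕ, Real.exp (-(c * n)) ∂(poissonMeasure r) =
      Real.exp (-(r * (1 - Real.exp (-c)))) := by
  rw [integral_poissonMeasure]
  have h : ∀ n : ℕ, (Real.exp (-r) * r ^ n / n.factorial) • Real.exp (-(c * n)) =
      Real.exp (-r) * ((r * Real.exp (-c)) ^ n / n.factorial) := by
    intro n
    rw [smul_eq_mul, mul_pow, ← Real.exp_nat_mul, show (n : ℝ) * -c = -(c * n) by ring]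
    ring
  simp_rw [h]
  have h' := (NormedSpace.expSeries_div_hasSum_exp (r * Real.exp (-c) : ℝ)).tsum_eq
  rw [← Real.exp_eq_exp_ℝ] at h'
  rw [tsum_mul_left, h', ← Real.exp_add]
  congr 1
  ring

lemma lintegral_natCast_poissonMeasure (r : NNReal) :
    ∫⁻ n : ℕ, (n : ENNReal) ∂(poissonMeasure r) = r := by
  rw [poissonMeasure, lintegral_sum_measure]
  simp_rw [lintegral_smul_measure, lintegral_dirac, smul_eq_mul]
  rw [tsum_eq_zero_add' ENNReal.summable]
  simp only [Nat.cast_zero, mul_zero, zero_add]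
  have h : ∀ n : ℕ, ENNReal.ofReal (Real.exp (-r) * r ^ (n + 1) / (n + 1).factorial) *
      ((n + 1 : ℕ) : ENNReal) = r * ENNReal.ofReal (Real.exp (-r) * r ^ n / n.factorial) := by
    intro n
    rw [← ENNReal.ofReal_natCast, ← ENNReal.ofReal_coe_nnreal (p := r),
      ← ENNReal.ofReal_mul (by positivity), ← ENNReal.ofReal_mul (by positivity)]
    congr 1
    rw [Nat.factorial_succ]
    have := n.factorial_ne_zero
    push_cast
    field_simp
    ring
  simp_rw [h]
  rw [ENNReal.tsum_mul_left, ← ENNReal.ofReal_tsum_of_nonneg (fun n => by positivity)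
    (hasSum_one_poissonMeasure r).summable, (hasSum_one_poissonMeasure r).tsum_eq]
  simp

lemma IsPoissonPointProcess.lintegral_pointCount (hΦ : IsPoissonPointProcess P x lam)
    (hlam : 0 ≤ lam) {B : Set Plane} (hB : MeasurableSet B) (hfin : volume B ≠ ⊤) :
    ∫⁻ ω, ((pointCount (fun i => x i ω) B : ℕ∞) : ENNReal) ∂P =
      ENNReal.ofReal lam * volume B := by
  have hm := measurable_pointCount hΦ.measurable hB
  rw [← lintegral_map (f := fun a : ℕ∞ => (a : ENNReal)) .of_discrete hm,
    hΦ.map_pointCount hlam hB hfin, lintegral_map .of_discrete .of_discrete]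
  simp only [ENat.toENNReal_coe]
  rw [lintegral_natCast_poissonMeasure, meanCount, ← ENNReal.ofReal, ENNReal.ofReal_mul hlam,
    ofReal_measureReal hfin]

/-- Campbell's formula: the expected number of points in a set is `lam` times its area. -/
lemma IsPoissonPointProcess.sum_map (hΦ : IsPoissonPointProcess P x lam) (hlam : 0 ≤ lam) :
    Measure.sum (fun i => P.map (x i)) = ENNReal.ofReal lam • volume := by
  refine (Measure.ext_iff_of_iUnion_eq_univ
    (iUnion_spanningSets (volume : Measure Plane))).mpr fun n => ?_
  ext B hB
  have hS := measurableSet_spanningSets (volume : Measure Plane) n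
  rw [Measure.restrict_apply hB, Measure.restrict_apply hB]
  have hBS := hB.inter hS
  have hfin : volume (B ∩ spanningSets (volume : Measure Plane) n) ≠ ⊤ :=
    ((measure_mono Set.inter_subset_right).trans_lt (measure_spanningSets_lt_top _ n)).ne
  generalize B ∩ spanningSets (volume : Measure Plane) n = C at hBS hfin
  rw [Measure.smul_apply, smul_eq_mul, ← hΦ.lintegral_pointCount hlam hBS hfin,
    Measure.sum_apply _ hBS]
  simp_rw [pointCount_toENNReal]
  have hm : ∀ i, AEMeasurable (fun ω => C.indicator (1 : Plane → ENNReal) (x i ω)) P := fun i =>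
    ((measurable_one.indicator hBS).comp (hΦ.measurable i)).aemeasurable
  rw [lintegral_tsum hm]
  refine tsum_congr fun i => ?_
  rw [Measure.map_apply (hΦ.measurable i) hBS, ← lintegral_map (measurable_one.indicator hBS)
    (hΦ.measurable i), lintegral_indicator_one hBS, Measure.map_apply (hΦ.measurable i) hBS]

/-- The truncated series has finite mean by Campbell's formula, and almost surely only finitely many
terms are changed by the truncation. -/
lemma IsPoissonPointProcess.ae_summable (hΦ : IsPoissonPointProcess P x lam) (hlam : 0 ≤ lam)
    {g : Plane → ℝ} (hg : Measurable g) (hg0 : ∀ y, 0 ≤ g y)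
    (hint : Integrable fun y => min 1 (g y)) : ∀ᵐ ω ∂P, Summable fun i => g (x i ω) := by
  have hm : Measurable fun y => ENNReal.ofReal (min 1 (g y)) := by fun_prop
  have h1 : ∫⁻ ω, ∑' i, ENNReal.ofReal (min 1 (g (x i ω))) ∂P ≠ ⊤ := by
    have hmi : ∀ i, AEMeasurable (fun ω => ENNReal.ofReal (min 1 (g (x i ω)))) P := fun i =>
      (hm.comp (hΦ.measurable i)).aemeasurable
    rw [lintegral_tsum hmi]
    have h2 : ∀ i, ∫⁻ ω, ENNReal.ofReal (min 1 (g (x i ω))) ∂P =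
        ∫⁻ y, ENNReal.ofReal (min 1 (g y)) ∂(P.map (x i)) := fun i =>
      (lintegral_map hm (hΦ.measurable i)).symm
    simp_rw [h2]
    rw [← lintegral_sum_measure, hΦ.sum_map hlam, lintegral_smul_measure]
    refine ENNReal.mul_ne_top ENNReal.ofReal_ne_top ?_
    have := hint.lintegral_lt_top
    exact this.ne
  have h3 := ae_lt_top (Measurable.tsum fun i => hm.comp (hΦ.measurable i)) h1
  filter_upwards [h3] with ω hω
  have h4 : Summable fun i => min 1 (g (x i ω)) := by
    have h5 := ENNReal.tsum_coe_ne_top_iff_summable.mp hω.ne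
    have h6 := NNReal.summable_coe.mpr h5
    refine h6.congr fun i => ?_
    exact Real.coe_toNNReal _ (le_min zero_le_one (hg0 _))
  refine h4.congr_cofinite ?_
  filter_upwards [h4.tendsto_cofinite_zero.eventually_lt_const zero_lt_one] with i hi
  rcases min_lt_iff.mp hi with h | h
  · exact absurd h (lt_irrefl _)
  · exact min_eq_right h.le

/-! ### The Laplace functional of a Poisson point process -/

lemma hasSum_indicator_pointCount {y : ℕ → Plane} {B : Set Plane} (c : ℝ)
    (hB : pointCount y B ≠ ⊤) :
    HasSum (fun i => B.indicator (fun _ => c) (y i)) (c * (pointCount y B).toNat) := by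
  have hfin : {i | y i ∈ B}.Finite := Set.encard_ne_top_iff.mp hB
  have h : c * (pointCount y B).toNat = ∑ i ∈ hfin.toFinset, B.indicator (fun _ => c) (y i) := by
    rw [pointCount, hfin.encard_eq_coe_toFinset_card, ENat.toNat_natCast, mul_comm, ← nsmul_eq_mul,
      ← Finset.sum_const]
    refine Finset.sum_congr rfl fun i hi => ?_
    rw [Set.indicator_of_mem (by simpa using hi)]
  rw [h]
  refine hasSum_sum_of_ne_finset_zero fun i hi => ?_
  rw [Set.indicator_of_notMem (by simpa using hi)]

lemma IsPoissonPointProcess.integral_exp_pointCount (hΦ : IsPoissonPointProcess P x lam)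
    (hlam : 0 ≤ lam) {B : Set Plane} (hB : MeasurableSet B) (hfin : volume B ≠ ⊤) (c : ℝ) :
    ∫ ω, Real.exp (-(c * (pointCount (fun i => x i ω) B).toNat)) ∂P =
      Real.exp (-(lam * ((1 - Real.exp (-c)) * volume.real B))) := by
  have hm := measurable_pointCount hΦ.measurable hB
  rw [← integral_map (f := fun a : ℕ∞ => Real.exp (-(c * a.toNat))) hm.aemeasurable
    .of_discrete, hΦ.map_pointCount hlam hB hfin, integral_map .of_discrete .of_discrete]
  simp only [ENat.toNat_natCast]
  rw [integral_exp_poissonMeasure, meanCount, Real.coe_toNNReal _ (by positivity)]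
  ring_nf

/-- The Laplace functional of a Poisson process at a step function: the counts in the disjoint
pieces are independent Poisson variables. -/
lemma IsPoissonPointProcess.integral_exp_neg_tsum_step (hΦ : IsPoissonPointProcess P x lam)
    (hlam : 0 ≤ lam) {m : ℕ} {B : Fin m → Set Plane} (hB : ∀ j, MeasurableSet (B j))
    (hfin : ∀ j, volume (B j) ≠ ⊤) (hd : ∀ i j, i ≠ j → Disjoint (B i) (B j)) (c : Fin m → ℝ) :
    ∫ ω, Real.exp (-∑' i, ∑ j, (B j).indicator (fun _ => c j) (x i ω)) ∂P =
      Real.exp (-(lam * ∑ j, (1 - Real.exp (-c j)) * volume.real (B j))) := by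
  have h1 : ∀ᵐ ω ∂P, Real.exp (-∑' i, ∑ j, (B j).indicator (fun _ => c j) (x i ω)) =
      ∏ j, Real.exp (-(c j * (pointCount (fun i => x i ω) (B j)).toNat)) := by
    have h2 := ae_all_iff.mpr fun j => hΦ.ae_pointCount_ne_top hlam (hB j) (hfin j)
    filter_upwards [h2] with ω hω
    have h3 := hasSum_sum (s := Finset.univ) fun j _ => hasSum_indicator_pointCount (c j) (hω j)
    rw [h3.tsum_eq, ← Real.exp_sum, Finset.sum_neg_distrib]
  rw [integral_congr_ae h1, (hΦ.indep m B hB hd).integral_fun_prod_comp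
    (f := fun j (a : ℕ∞) => Real.exp (-(c j * a.toNat)))
    (fun j => (measurable_pointCount hΦ.measurable (hB j)).aemeasurable)
    (fun j => .of_discrete)]
  simp_rw [fun j => hΦ.integral_exp_pointCount hlam (hB j) (hfin j) (c j)]
  rw [← Real.exp_sum, Finset.sum_neg_distrib, Finset.mul_sum]

/-- The Laplace functional of a Poisson point process. The simple functions that increase to `g`
reduce it to step functions. -/
lemma IsPoissonPointProcess.integral_exp_neg_tsum (hΦ : IsPoissonPointProcess P x lam)
    (hlam : 0 ≤ lam) {g : Plane → ℝ} (hg : Measurable g) (hg0 : ∀ y, 0 ≤ g y)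
    (hint : Integrable fun y => min 1 (g y)) :
    ∫ ω, Real.exp (-∑' i, g (x i ω)) ∂P =
      Real.exp (-(lam * ∫ y, (1 - Real.exp (-g y)))) := by
  set s : ℕ → SimpleFunc Plane ENNReal :=
    SimpleFunc.eapprox fun y => ENNReal.ofReal (g y) with hs
  have hs_le : ∀ n y, s n y ≤ ENNReal.ofReal (g y) := fun n y => by
    rw [← SimpleFunc.iSup_eapprox_apply (f := fun y => ENNReal.ofReal (g y)) (by fun_prop) y]
    exact le_iSup (fun n => s n y) n
  have hr_le : ∀ n y, (s n y).toReal ≤ g y := fun n y =>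
    ENNReal.toReal_le_of_le_ofReal (hg0 y) (hs_le n y)
  have hr_tendsto : ∀ y, Filter.Tendsto (fun n => (s n y).toReal) Filter.atTop (nhds (g y)) := by
    intro y
    have h := SimpleFunc.tendsto_eapprox (f := fun y => ENNReal.ofReal (g y)) (by fun_prop) y
    have h' := (ENNReal.tendsto_toReal ENNReal.ofReal_ne_top).comp h
    rwa [ENNReal.toReal_ofReal (hg0 y)] at h'
  have hstep : ∀ n, ∫ ω, Real.exp (-∑' i, (s n (x i ω)).toReal) ∂P =
      Real.exp (-(lam * ∫ y, (1 - Real.exp (-(s n y).toReal)))) := by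
    intro n
    set F := (s n).range.filter (fun c => c ≠ 0) with hF
    let e := F.equivFin
    let v : Fin F.card → ENNReal := fun j => (e.symm j : ENNReal)
    have hv : ∀ j, v j ∈ F := fun j => (e.symm j).2
    have hv0 : ∀ j, v j ≠ 0 := fun j => (Finset.mem_filter.mp (hv j)).2
    have hvt : ∀ j, v j ≠ ⊤ := by
      intro j
      obtain ⟨y, hy⟩ := SimpleFunc.mem_range.mp (Finset.mem_filter.mp (hv j)).1
      rw [← hy]
      exact (SimpleFunc.eapprox_lt_top _ n y).ne
    let B : Fin F.card → Set Plane := fun j => s n ⁻¹' {v j}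
    have hB : ∀ j, MeasurableSet (B j) := fun j => (s n).measurableSet_fiber _
    have hpos : ∀ j, 0 < (v j).toReal := fun j => ENNReal.toReal_pos (hv0 j) (hvt j)
    have hfin : ∀ j, volume (B j) ≠ ⊤ := by
      intro j
      refine ((measure_mono ?_).trans_lt (hint.measure_ge_lt_top
        (ε := min 1 (v j).toReal) (lt_min one_pos (hpos j)))).ne
      intro y (hy : s n y = v j)
      exact min_le_min le_rfl (hy ▸ hr_le n y)
    have hd : ∀ i j, i ≠ j → Disjoint (B i) (B j) := by
      intro i j hij
      refine Disjoint.preimage _ (Set.disjoint_singleton.mpr fun h => hij ?_)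
      exact e.symm.injective (Subtype.ext h)
    -- Any function of the simple function that vanishes at `0` is a step function on the `B j`.
    have hrep : ∀ (φ : ℝ → ℝ), φ 0 = 0 → ∀ y, φ (s n y).toReal =
        ∑ j, (B j).indicator (fun _ => φ (v j).toReal) y := by
      intro φ hφ y
      by_cases hy : s n y = 0
      · rw [hy, ENNReal.toReal_zero, hφ]
        refine (Finset.sum_eq_zero fun j _ => Set.indicator_of_notMem ?_ _).symm
        intro (h : s n y = v j)
        exact hv0 j (h ▸ hy)
      · have hmem : s n y ∈ F := Finset.mem_filter.mpr ⟨(s n).mem_range_self y, hy⟩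
        have hvj : v (e ⟨s n y, hmem⟩) = s n y := by simp [v]
        have hyB : y ∈ B (e ⟨s n y, hmem⟩) := hvj.symm
        rw [Finset.sum_eq_single (e ⟨s n y, hmem⟩)]
        · rw [Set.indicator_of_mem hyB, hvj]
        · intro j _ hj
          have hyj : y ∉ B j := by
            intro (h : s n y = v j)
            refine hj ?_
            have : (⟨s n y, hmem⟩ : F) = e.symm j := Subtype.ext h
            rw [this, Equiv.apply_symm_apply]
          exact Set.indicator_of_notMem hyj _
        · simp
    have h1 := hΦ.integral_exp_neg_tsum_step hlam hB hfin hd fun j => (v j).toReal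
    have h2 : ∫ y, (1 - Real.exp (-(s n y).toReal)) =
        ∑ j, (1 - Real.exp (-(v j).toReal)) * volume.real (B j) := by
      simp_rw [hrep (fun t => 1 - Real.exp (-t)) (by simp)]
      rw [integral_finsetSum]
      · refine Finset.sum_congr rfl fun j _ => ?_
        rw [integral_indicator_const _ (hB j), smul_eq_mul, mul_comm]
      · intro j _
        exact (integrable_indicator_iff (hB j)).mpr (integrableOn_const (hfin j))
    rw [h2, ← h1]
    simp_rw [← hrep (fun t => t) rfl]
  have hL : Filter.Tendsto (fun n => ∫ ω, Real.exp (-∑' i, (s n (x i ω)).toReal) ∂P)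
      Filter.atTop (nhds (∫ ω, Real.exp (-∑' i, g (x i ω)) ∂P)) := by
    refine tendsto_integral_of_dominated_convergence (fun _ => 1) ?_ (integrable_const _) ?_ ?_
    · intro n
      have hm : Measurable fun ω => ∑' i, (s n (x i ω)).toReal := Measurable.tsum fun i =>
        ((s n).measurable.comp (hΦ.measurable i)).ennreal_toReal
      exact hm.neg.exp.aestronglyMeasurable
    · intro n
      refine Filter.Eventually.of_forall fun ω => ?_
      rw [Real.norm_of_nonneg (Real.exp_nonneg _), Real.exp_le_one_iff, neg_nonpos]
      exact tsum_nonneg fun i => ENNReal.toReal_nonneg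
    · filter_upwards [hΦ.ae_summable hlam hg hg0 hint] with ω hω
      refine (Real.continuous_exp.tendsto _).comp (Filter.Tendsto.neg ?_)
      refine tendsto_tsum_of_dominated_convergence hω (fun i => hr_tendsto _) ?_
      refine Filter.Eventually.of_forall fun n i => ?_
      rw [Real.norm_of_nonneg ENNReal.toReal_nonneg]
      exact hr_le n _
  have hR : Filter.Tendsto (fun n => Real.exp (-(lam * ∫ y, (1 - Real.exp (-(s n y).toReal)))))
      Filter.atTop (nhds (Real.exp (-(lam * ∫ y, (1 - Real.exp (-g y)))))) := by
    refine (Real.continuous_exp.tendsto _).comp (Filter.Tendsto.neg (Filter.Tendsto.const_mul _ ?_))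
    refine tendsto_integral_of_dominated_convergence (fun y => min 1 (g y)) ?_ hint ?_ ?_
    · intro n
      exact (measurable_const.sub
        (s n).measurable.ennreal_toReal.neg.exp).aestronglyMeasurable
    · intro n
      refine Filter.Eventually.of_forall fun y => ?_
      have h0 : Real.exp (-(s n y).toReal) ≤ 1 := by
        rw [Real.exp_le_one_iff, neg_nonpos]; exact ENNReal.toReal_nonneg
      rw [Real.norm_of_nonneg (by linarith)]
      refine le_min (by linarith [Real.exp_pos (-(s n y).toReal)]) ?_
      linarith [Real.add_one_le_exp (-(s n y).toReal), hr_le n y]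
    · refine Filter.Eventually.of_forall fun y => ?_
      exact (Filter.Tendsto.const_sub _ ((Real.continuous_exp.tendsto _).comp (hr_tendsto y).neg))
  simp_rw [hstep] at hL
  exact tendsto_nhds_unique hL hR

end PoissonProcess

/-! ### The path-loss integral -/

/-- At infinity `‖y‖ ^ (-α)` is integrable because `α` exceeds the dimension; the truncation takes
care of the singularity at the origin. -/
lemma integrable_min_one_pathLoss {α : ℝ} (hα : 2 < α) {a : ℝ} (ha : 0 ≤ a) :
    Integrable fun y : Plane => min 1 (a * ‖y‖ ^ (-α)) := by
  have h := (integrable_one_add_norm (E := Plane) (μ := volume) (r := α)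
    (by simpa using hα)).const_mul ((1 + a) * 2 ^ α)
  have hm : Measurable fun y : Plane => min 1 (a * ‖y‖ ^ (-α)) := by fun_prop
  refine h.mono' hm.aestronglyMeasurable (Filter.Eventually.of_forall fun y => ?_)
  have hn := norm_nonneg y
  have h2 : (2 : ℝ) ^ α * (1 + ‖y‖) ^ (-α) = ((1 + ‖y‖) / 2) ^ (-α) := by
    rw [Real.div_rpow (by positivity) (by norm_num), Real.rpow_neg (by norm_num : (0 : ℝ) ≤ 2)]
    field_simp
  rw [Real.norm_of_nonneg (le_min zero_le_one (by positivity)), mul_assoc, h2]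
  rcases le_total ‖y‖ 1 with hy | hy
  · have h3 : 1 ≤ ((1 + ‖y‖) / 2) ^ (-α) :=
      Real.one_le_rpow_of_pos_of_le_one_of_nonpos (by positivity) (by linarith) (by linarith)
    exact (min_le_left _ _).trans (by nlinarith)
  · have h3 : ‖y‖ ^ (-α) ≤ ((1 + ‖y‖) / 2) ^ (-α) :=
      Real.rpow_le_rpow_of_nonpos (by positivity) (by linarith) (by linarith)
    have h4 : 0 ≤ ((1 + ‖y‖) / 2) ^ (-α) := by positivity
    refine (min_le_right _ _).trans ((mul_le_mul_of_nonneg_left h3 ha).trans ?_)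
    nlinarith

lemma integrable_pathLoss_quotient {α : ℝ} (hα : 2 < α) {a : ℝ} (ha : 0 < a) :
    Integrable fun y : Plane => a / (a + ‖y‖ ^ α) := by
  have hm : Measurable fun y : Plane => a / (a + ‖y‖ ^ α) := by fun_prop
  refine (integrable_min_one_pathLoss hα ha.le).mono' hm.aestronglyMeasurable ?_
  have h0 : ∀ᵐ y : Plane, y ≠ 0 := Measure.ae_ne volume 0
  filter_upwards [h0] with y hy
  have hy' : 0 < ‖y‖ ^ α := Real.rpow_pos_of_pos (norm_pos_iff.mpr hy) _
  rw [Real.norm_of_nonneg (by positivity)]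
  refine le_min ((div_le_one (by positivity)).mpr (by linarith)) ?_
  rw [Real.rpow_neg (norm_nonneg y), ← div_eq_mul_inv]
  exact div_le_div_of_nonneg_left ha.le hy' (by linarith)

/-- Writing `1 / (a + r ^ α)` as a Laplace integral turns the integral into a product of two Gamma
integrals, to which Euler's reflection formula applies. -/
lemma integral_radial_pathLoss {α : ℝ} (hα : 2 < α) {a : ℝ} (ha : 0 < a) :
    ∫ r in Set.Ioi (0 : ℝ), r * (a / (a + r ^ α)) =
      a ^ (2 / α) / α * (Real.pi / Real.sin (2 * Real.pi / α)) := by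
  have hα0 : 0 < α := by linarith
  have hIt : ∀ r ∈ Set.Ioi (0 : ℝ), ∫ t in Set.Ioi (0 : ℝ),
      r * (a * Real.exp (-(a + r ^ α) * t)) = r * (a / (a + r ^ α)) := by
    intro r hr
    have hr' : 0 < r ^ α := Real.rpow_pos_of_pos hr _
    have h := integral_exp_mul_Ioi (a := -(a + r ^ α)) (by linarith) 0
    rw [integral_const_mul, integral_const_mul, h, mul_zero, Real.exp_zero, neg_div_neg_eq,
      mul_one_div]
  have hIr : ∀ t ∈ Set.Ioi (0 : ℝ), ∫ r in Set.Ioi (0 : ℝ),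
      r * (a * Real.exp (-(a + r ^ α) * t)) =
      a / α * Real.Gamma (2 / α) * (t ^ ((1 - 2 / α) - 1) * Real.exp (-(a * t))) := by
    intro t ht
    have h := integral_rpow_mul_exp_neg_mul_rpow (p := α) (q := 1) (b := t) hα0 (by norm_num) ht
    have h1 : ∀ r : ℝ, r * (a * Real.exp (-(a + r ^ α) * t)) =
        a * Real.exp (-(a * t)) * (r ^ (1 : ℝ) * Real.exp (-t * r ^ α)) := by
      intro r
      rw [Real.rpow_one, show -(a + r ^ α) * t = -(a * t) + -t * r ^ α by ring, Real.exp_add]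
      ring
    simp_rw [h1]
    rw [integral_const_mul, h, show (1 : ℝ) + 1 = 2 by norm_num,
      show 1 - 2 / α - 1 = -2 / α by ring]
    ring
  have hint : Integrable (Function.uncurry fun r t : ℝ => r * (a * Real.exp (-(a + r ^ α) * t)))
      ((volume.restrict (Set.Ioi 0)).prod (volume.restrict (Set.Ioi 0))) := by
    have hm : Measurable (Function.uncurry fun r t : ℝ =>
        r * (a * Real.exp (-(a + r ^ α) * t))) := by
      unfold Function.uncurry
      fun_prop
    rw [integrable_prod_iff hm.aestronglyMeasurable]
    constructor
    · filter_upwards [ae_restrict_mem measurableSet_Ioi] with r hr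
      have hr' : 0 < r ^ α := Real.rpow_pos_of_pos hr _
      exact ((integrableOn_exp_mul_Ioi (a := -(a + r ^ α)) (by linarith) 0).const_mul a).const_mul r
    · have h := (integrable_fun_norm_addHaar (E := Plane) volume
        (f := fun r => a / (a + r ^ α))).mp (integrable_pathLoss_quotient hα ha)
      refine Integrable.congr h ?_
      filter_upwards [ae_restrict_mem measurableSet_Ioi] with r hr
      have hr0 : 0 < r := hr
      have h1 : ∀ t : ℝ, ‖Function.uncurry (fun r t : ℝ =>
          r * (a * Real.exp (-(a + r ^ α) * t))) (r, t)‖ =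
          r * (a * Real.exp (-(a + r ^ α) * t)) := fun t =>
        Real.norm_of_nonneg (by simp only [Function.uncurry]; positivity)
      simp_rw [h1]
      rw [hIt r hr]
      simp
  have hp : 0 < 1 - 2 / α := by
    have : 2 / α < 1 := (div_lt_one hα0).mpr hα
    linarith
  calc _ = ∫ r in Set.Ioi (0 : ℝ), ∫ t in Set.Ioi (0 : ℝ),
        r * (a * Real.exp (-(a + r ^ α) * t)) :=
        (setIntegral_congr_fun measurableSet_Ioi hIt).symm
    _ = ∫ t in Set.Ioi (0 : ℝ), ∫ r in Set.Ioi (0 : ℝ),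
        r * (a * Real.exp (-(a + r ^ α) * t)) := integral_integral_swap hint
    _ = _ := by
        rw [setIntegral_congr_fun measurableSet_Ioi hIr, integral_const_mul,
          Real.integral_rpow_mul_exp_neg_mul_Ioi hp ha]
        have hrefl := Real.Gamma_mul_Gamma_one_sub (2 / α)
        rw [show Real.pi * (2 / α) = 2 * Real.pi / α by ring] at hrefl
        rw [← hrefl, one_div, Real.inv_rpow ha.le, Real.rpow_sub ha, Real.rpow_one]
        have := (Real.rpow_pos_of_pos ha (2 / α)).ne'
        field_simp

lemma integral_pathLoss {α : ℝ} (hα : 2 < α) {a : ℝ} (ha : 0 < a) :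
    ∫ y : Plane, (1 - 1 / (1 + a * ‖y‖ ^ (-α))) =
      2 * Real.pi * (a ^ (2 / α) / α * (Real.pi / Real.sin (2 * Real.pi / α))) := by
  have h := integral_fun_norm_addHaar (E := Plane) volume (fun r => 1 - 1 / (1 + a * r ^ (-α)))
  rw [h, ← integral_radial_pathLoss hα ha]
  have hvol : (volume : Measure Plane).real (Metric.ball 0 1) = Real.pi := by
    rw [Measure.real, EuclideanSpace.volume_ball_fin_two]
    simp [Real.pi_pos.le]
  have hI : ∫ r in Set.Ioi (0 : ℝ), r ^ (Module.finrank ℝ Plane - 1) •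
      (1 - 1 / (1 + a * r ^ (-α))) = ∫ r in Set.Ioi (0 : ℝ), r * (a / (a + r ^ α)) := by
    refine setIntegral_congr_fun measurableSet_Ioi fun r hr => ?_
    have hr' : 0 < r ^ α := Real.rpow_pos_of_pos hr _
    simp only [finrank_euclideanSpace_fin, Nat.add_one_sub_one, pow_one, smul_eq_mul]
    rw [Real.rpow_neg (le_of_lt hr)]
    field_simp
    ring
  rw [hI, hvol, finrank_euclideanSpace_fin]
  simp only [nsmul_eq_mul, smul_eq_mul]
  push_cast
  ring

/-! ### Series with exponential coefficients -/

lemma multipliable_one_div_one_add {c : ℕ → ℝ} (hc0 : ∀ k, 0 ≤ c k) (hc : Summable c) :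
    Multipliable fun k => 1 / (1 + c k) := by
  refine Real.multipliable_of_summable_log (fun k => by have := hc0 k; positivity) ?_
  refine (Real.summable_log_one_add_of_summable hc).neg.congr fun k => ?_
  rw [one_div, Real.log_inv]

lemma ae_pos_infinitePi_expMeasure :
    ∀ᵐ s ∂(Measure.infinitePi fun _ : ℕ => expMeasure 1), ∀ k, 0 < s k :=
  ae_all_iff.mpr fun k =>
    (measurePreserving_eval_infinitePi (fun _ : ℕ => expMeasure 1) k).quasiMeasurePreserving.ae
      ae_pos_expMeasure

/-- The exponential variables have finite mean, so that the series has a finite expectation. -/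
lemma ae_summable_mul_infinitePi_expMeasure {c : ℕ → ℝ} (hc0 : ∀ k, 0 ≤ c k) (hc : Summable c) :
    ∀ᵐ s ∂(Measure.infinitePi fun _ : ℕ => expMeasure 1), Summable fun k => c k * s k := by
  have hm : ∀ k, Measurable fun s : ℕ → ℝ => ENNReal.ofReal (c k * s k) := fun k => by fun_prop
  have h1 : ∫⁻ s, ∑' k, ENNReal.ofReal (c k * s k)
      ∂(Measure.infinitePi fun _ : ℕ => expMeasure 1) ≠ ⊤ := by
    rw [lintegral_tsum fun k => (hm k).aemeasurable]
    have h2 : ∀ k, ∫⁻ s, ENNReal.ofReal (c k * s k)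
        ∂(Measure.infinitePi fun _ : ℕ => expMeasure 1) =
        ENNReal.ofReal (c k) * ∫⁻ t, ENNReal.ofReal t ∂(expMeasure 1) := fun k => by
      simp_rw [ENNReal.ofReal_mul (hc0 k)]
      rw [lintegral_const_mul _ (by fun_prop),
        ← (measurePreserving_eval_infinitePi (fun _ : ℕ => expMeasure 1) k).lintegral_comp
          ENNReal.measurable_ofReal]
    simp_rw [h2]
    rw [ENNReal.tsum_mul_right, ← ENNReal.ofReal_tsum_of_nonneg hc0 hc]
    exact ENNReal.mul_ne_top ENNReal.ofReal_ne_top integrable_id_expMeasure.lintegral_lt_top.ne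
  filter_upwards [ae_lt_top (Measurable.tsum hm) h1, ae_pos_infinitePi_expMeasure] with s hs hpos
  refine (NNReal.summable_coe.mpr (ENNReal.tsum_coe_ne_top_iff_summable.mp hs.ne)).congr
    fun k => ?_
  exact Real.coe_toNNReal _ (mul_nonneg (hc0 k) (hpos k).le)

/-- The Laplace transform of a series of independent exponential variables. -/
lemma integral_exp_neg_tsum_infinitePi_expMeasure {c : ℕ → ℝ} (hc0 : ∀ k, 0 ≤ c k)
    (hc : Summable c) :
    ∫ s, Real.exp (-∑' k, c k * s k) ∂(Measure.infinitePi fun _ : ℕ => expMeasure 1) =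
      ∏' k, 1 / (1 + c k) := by
  set E := Measure.infinitePi fun _ : ℕ => expMeasure 1 with hE
  have hfin : ∀ K : ℕ, ∫ s, Real.exp (-∑ k ∈ Finset.range K, c k * s k) ∂E =
      ∏ k ∈ Finset.range K, 1 / (1 + c k) := by
    intro K
    have hind : iIndepFun (fun (k : Fin K) (s : ℕ → ℝ) => s k) E :=
      (iIndepFun_infinitePi (P := fun _ : ℕ => expMeasure 1) (X := fun _ t => t)
        (fun _ => measurable_id)).precomp (g := fun k : Fin K => (k : ℕ)) Fin.val_injective
    have h := iIndepFun.integral_fun_prod_comp (𝓧 := fun _ : Fin K => ℝ)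
      (X := fun (k : Fin K) (s : ℕ → ℝ) => s k) (f := fun k t => Real.exp (-(c k * t))) hind
      (fun k => (measurable_pi_apply (k : ℕ)).aemeasurable) (fun k => by fun_prop)
    rw [Finset.prod_range]
    simp_rw [Finset.sum_range, ← Finset.sum_neg_distrib, Real.exp_sum]
    rw [h]
    refine Finset.prod_congr rfl fun k _ => ?_
    rw [← integral_exp_neg_mul_expMeasure (hc0 k), ← Measure.infinitePi_map_eval
      (fun _ : ℕ => expMeasure 1) (k : ℕ), integral_map (measurable_pi_apply _).aemeasurable
      (by fun_prop)]
  have hL : Filter.Tendsto (fun K => ∫ s, Real.exp (-∑ k ∈ Finset.range K, c k * s k) ∂E)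
      Filter.atTop (nhds (∫ s, Real.exp (-∑' k, c k * s k) ∂E)) := by
    refine tendsto_integral_of_dominated_convergence (fun _ => 1) (fun K => ?_)
      (integrable_const _) (fun K => ?_) ?_
    · have hm : Measurable fun s : ℕ → ℝ => ∑ k ∈ Finset.range K, c k * s k := by fun_prop
      exact hm.neg.exp.aestronglyMeasurable
    · filter_upwards [ae_pos_infinitePi_expMeasure] with s hs
      rw [Real.norm_of_nonneg (Real.exp_nonneg _), Real.exp_le_one_iff, neg_nonpos]
      exact Finset.sum_nonneg fun k _ => mul_nonneg (hc0 k) (hs k).le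
    · filter_upwards [ae_summable_mul_infinitePi_expMeasure hc0 hc] with s hs
      exact (Real.continuous_exp.tendsto _).comp hs.hasSum.tendsto_sum_nat.neg
  simp_rw [hfin] at hL
  exact tendsto_nhds_unique hL (multipliable_one_div_one_add hc0 hc).hasProd.tendsto_prod_nat

/-! ### The interference -/

lemma measurableSet_setOf_summable {β : Type*} [MeasurableSpace β] {f : ℕ → β → ℝ}
    (hf : ∀ k, Measurable (f k)) : MeasurableSet {b | Summable fun k => f k b} := by
  have h : {b | Summable fun k => f k b} = {b | ∑' k, ‖f k b‖ₑ < ⊤} := by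
    ext b
    rw [Set.mem_ofPred_eq, Set.mem_ofPred_eq, lt_top_iff_ne_top,
      tsum_enorm_ne_top_iff_summable_norm, summable_norm_iff]
  rw [h]
  exact measurableSet_lt (Measurable.tsum fun k => (hf k).enorm) measurable_const

lemma tprod_one_div_one_add_mem_Icc {c : ℕ → ℝ} (hc0 : ∀ k, 0 ≤ c k) (hc : Summable c) :
    ∏' k, 1 / (1 + c k) ∈ Set.Icc (0 : ℝ) 1 := by
  have h := (multipliable_one_div_one_add hc0 hc).hasProd.tendsto_prod_nat
  refine isClosed_Icc.mem_of_tendsto h (Filter.Eventually.of_forall fun K => ⟨?_, ?_⟩)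
  · exact Finset.prod_nonneg fun k _ => by have := hc0 k; positivity
  · refine Finset.prod_le_one (fun k _ => by have := hc0 k; positivity) fun k _ => ?_
    have := hc0 k
    exact (div_le_one (by positivity)).mpr (by linarith)

/-- The interference caused by the interferers of index at least `M` as a function of the locations
and of the effective gains. -/
noncomputable def interferenceSeries (ρ α : ℝ) (M : ℕ) (q : (ℕ → Plane) × (ℕ → ℝ)) : ℝ :=
  ∑' k : ℕ, ρ * ‖q.1 (M + k)‖ ^ (-α) * q.2 k

lemma measurable_interferenceSeries (ρ α : ℝ) (M : ℕ) :
    Measurable (interferenceSeries ρ α M) :=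
  Measurable.tsum fun k => by fun_prop

lemma integrable_exp_neg_of_nonneg {β : Type*} [MeasurableSpace β] {ν : Measure β}
    [IsFiniteMeasure ν] {J : β → ℝ} (hJ : AEMeasurable J ν) (hJ0 : ∀ᵐ q ∂ν, 0 ≤ J q) :
    Integrable (fun q => Real.exp (-J q)) ν := by
  refine Integrable.of_bound hJ.neg.exp.aestronglyMeasurable 1 ?_
  filter_upwards [hJ0] with q hq
  rwa [Real.norm_of_nonneg (Real.exp_nonneg _), Real.exp_le_one_iff, neg_nonpos]

section Interference

variable {ρ α : ℝ}

lemma measurable_tprod_laplaceFactor (ρ α : ℝ) (M : ℕ) (s : ℝ) :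
    Measurable fun y : ℕ → Plane => ∏' k, laplaceFactor ρ α y M s k :=
  Measurable.tprod fun k => by unfold laplaceFactor; fun_prop

lemma pathLoss_nonneg (hρ : 0 < ρ) {s : ℝ} (hs : 0 ≤ s) (y : Plane) :
    0 ≤ s * ρ * ‖y‖ ^ (-α) := by positivity

lemma summable_pathLoss_add {y : ℕ → Plane} (hy : Summable fun i => ‖y i‖ ^ (-α)) (M : ℕ) (a : ℝ) :
    Summable fun k => a * ‖y (M + k)‖ ^ (-α) := by
  have h := ((summable_nat_add_iff M).mpr hy).mul_left a
  exact h.congr fun k => by rw [add_comm k M]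

/-- Almost sure properties of the interference when the gains are independent exponential variables
that are independent of the locations. -/
lemma ae_interferenceSeries (hρ : 0 < ρ) {μ : Measure (ℕ → Plane)}
    (hμ : ∀ᵐ y ∂μ, Summable fun i => ‖y i‖ ^ (-α)) (hμ0 : ∀ᵐ y ∂μ, ∀ i, y i ≠ 0) (M : ℕ) :
    ∀ᵐ q ∂(μ.prod (Measure.infinitePi fun _ : ℕ => expMeasure 1)),
      (Summable fun k => ρ * ‖q.1 (M + k)‖ ^ (-α) * q.2 k) ∧ 0 < interferenceSeries ρ α M q := by
  have hms : MeasurableSet {q : (ℕ → Plane) × (ℕ → ℝ) |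
      (Summable fun k => ρ * ‖q.1 (M + k)‖ ^ (-α) * q.2 k) ∧ 0 < interferenceSeries ρ α M q} :=
    (measurableSet_setOf_summable fun k => by fun_prop).inter
      (measurableSet_lt measurable_const (measurable_interferenceSeries ρ α M))
  refine (Measure.ae_prod_mem_iff_ae_ae_mem hms).mpr ?_
  filter_upwards [hμ, hμ0] with y hy hy0
  filter_upwards [ae_summable_mul_infinitePi_expMeasure (c := fun k => ρ * ‖y (M + k)‖ ^ (-α))
    (fun k => by positivity) (summable_pathLoss_add hy M ρ), ae_pos_infinitePi_expMeasure]
    with s hs hpos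
  have h0 : ∀ k, 0 < ρ * ‖y (M + k)‖ ^ (-α) * s k := fun k =>
    mul_pos (mul_pos hρ (Real.rpow_pos_of_pos (norm_pos_iff.mpr (hy0 _)) _)) (hpos k)
  exact ⟨hs, hs.tsum_pos (fun k => (h0 k).le) 0 (h0 0)⟩

/-- The Laplace transform of the interference, by integrating out the gains. -/
lemma integral_exp_neg_interferenceSeries (hρ : 0 < ρ) {μ : Measure (ℕ → Plane)}
    [IsProbabilityMeasure μ]
    (hμ : ∀ᵐ y ∂μ, Summable fun i => ‖y i‖ ^ (-α)) (hμ0 : ∀ᵐ y ∂μ, ∀ i, y i ≠ 0) (M : ℕ)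
    {s : ℝ} (hs : 0 ≤ s) :
    ∫ q, Real.exp (-(s * interferenceSeries ρ α M q))
      ∂(μ.prod (Measure.infinitePi fun _ : ℕ => expMeasure 1)) =
    ∫ y, ∏' k, laplaceFactor ρ α y M s k ∂μ := by
  rw [integral_prod _ (integrable_exp_neg_of_nonneg
    ((measurable_interferenceSeries ρ α M).const_mul s).aemeasurable ?_)]
  · refine integral_congr_ae ?_
    filter_upwards [hμ] with y hy
    have h := integral_exp_neg_tsum_infinitePi_expMeasure
      (c := fun k => s * ρ * ‖y (M + k)‖ ^ (-α)) (fun k => pathLoss_nonneg hρ hs _)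
      (summable_pathLoss_add hy M (s * ρ))
    simp only [laplaceFactor]
    rw [← h]
    refine integral_congr_ae (Filter.Eventually.of_forall fun t => ?_)
    simp only [interferenceSeries]
    rw [← tsum_mul_left]
    simp only [mul_assoc]
  · filter_upwards [ae_interferenceSeries hρ hμ hμ0 M] with q hq
    exact mul_nonneg hs hq.2.le

end Interference

section Network

variable {Ω : Type*} [MeasurableSpace Ω] {P : Measure Ω} [IsProbabilityMeasure P] {N : ℕ}
  {ρ α lam : ℝ} {x : ℕ → Ω → Plane} {h : ℕ → Ω → EuclideanSpace ℂ (Fin N)}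

lemma IsPoissonPointProcess.ae_ne_zero (hΦ : IsPoissonPointProcess P x lam) (hlam : 0 ≤ lam) :
    ∀ᵐ ω ∂P, ∀ i, x i ω ≠ 0 := by
  refine ae_all_iff.mpr fun i => ?_
  have h1 : Measure.sum (fun i => P.map (x i)) {0} = 0 := by
    rw [hΦ.sum_map hlam, Measure.smul_apply, measure_singleton, smul_zero]
  rw [Measure.sum_apply _ (measurableSet_singleton 0), ENNReal.tsum_eq_zero] at h1
  have h2 := h1 i
  rw [Measure.map_apply (hΦ.measurable i) (measurableSet_singleton 0)] at h2
  exact measure_eq_zero_iff_ae_notMem.mp h2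

lemma IsPoissonPointProcess.ae_summable_pathLoss (hΦ : IsPoissonPointProcess P x lam)
    (hlam : 0 ≤ lam) (hα : 2 < α) : ∀ᵐ ω ∂P, Summable fun i => ‖x i ω‖ ^ (-α) :=
  hΦ.ae_summable (g := fun y => ‖y‖ ^ (-α)) hlam (by fun_prop) (fun y => by positivity)
    (by simpa using integrable_min_one_pathLoss hα zero_le_one)

/-- In the joint distribution of the gain of the transmitter, the locations and the gains of the
interferers that are not cancelled, the gain of the transmitter is independent of the rest. -/
lemma measurePreserving_gain_zero_locations_gains
    (hx : ∀ i, Measurable (x i)) (hmeas : ∀ j, Measurable (h j))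
    (hlaw : ∀ j, P.map (h j) = stdComplexGaussianVec N) (hindep : iIndepFun h P)
    (hxh : IndepFun (fun ω i => x i ω) (fun ω j => h j ω) P) {M n : ℕ} (hn : M + (n + 1) = N) :
    MeasurePreserving (fun ω => (gain (fun j => h j ω) M 0, ((fun i => x i ω),
        fun k => gain (fun j => h j ω) M (M + k + 1)))) P
      ((gammaMeasure (n + 1 : ℕ) 1).prod ((P.map fun ω i => x i ω).prod
        (Measure.infinitePi fun _ : ℕ => expMeasure 1))) := by
  have hxm : Measurable fun ω i => x i ω := measurable_pi_lambda _ hx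
  have : IsProbabilityMeasure (P.map fun ω i => x i ω) :=
    Measure.isProbabilityMeasure_map hxm.aemeasurable
  have h1 := measurePreserving_locations_gains hx hmeas hlaw hindep hxh hn
  have h2 := (measurePreserving_prodAssoc (P.map fun ω i => x i ω) (gammaMeasure (n + 1 : ℕ) 1)
    (Measure.infinitePi fun _ : ℕ => expMeasure 1)).symm
  have h3 : MeasurePreserving (Prod.map Prod.swap id) (((P.map fun ω i => x i ω).prod
      (gammaMeasure (n + 1 : ℕ) 1)).prod (Measure.infinitePi fun _ : ℕ => expMeasure 1)) _ :=
    Measure.measurePreserving_swap.prod (MeasurePreserving.id _)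
  exact (measurePreserving_prodAssoc _ _ _).comp (h3.comp (h2.comp h1))

end Network

/-! ### Gamma tails and derivatives of the Laplace transform -/

/-- The probability that a variable of Gamma distribution of integer shape exceeds an independent
nonnegative variable. -/
lemma measureReal_lt_of_gammaMeasure {Ω β : Type*} [MeasurableSpace Ω] [MeasurableSpace β]
    {P : Measure Ω} {ν : Measure β} [IsProbabilityMeasure ν] {n : ℕ} {G : Ω → ℝ} {Y : Ω → β}
    (hGY : MeasurePreserving (fun ω => (G ω, Y ω)) P ((gammaMeasure (n + 1 : ℕ) 1).prod ν))
    {J : β → ℝ} (hJ : Measurable J) (hJ0 : ∀ᵐ q ∂ν, 0 ≤ J q) :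
    P.real {ω | J (Y ω) < G ω} = ∫ ω, ∑ k ∈ Finset.range (n + 1),
      J (Y ω) ^ k / k.factorial * Real.exp (-J (Y ω)) ∂P := by
  have hs : MeasurableSet {q : ℝ × β | J q.2 < q.1} :=
    measurableSet_lt (hJ.comp measurable_snd) measurable_fst
  have hY : MeasurePreserving Y P ν := measurePreserving_snd.comp hGY
  have hf : Measurable fun q => ∑ k ∈ Finset.range (n + 1),
      J q ^ k / k.factorial * Real.exp (-J q) := by fun_prop
  have h1 : P.real {ω | J (Y ω) < G ω} =
      ((gammaMeasure (n + 1 : ℕ) 1).prod ν).real {q : ℝ × β | J q.2 < q.1} := by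
    rw [Measure.real, Measure.real, ← hGY.map_eq, Measure.map_apply hGY.measurable hs]
    rfl
  rw [h1, ← integral_map (f := fun q => ∑ k ∈ Finset.range (n + 1),
      J q ^ k / k.factorial * Real.exp (-J q)) hY.measurable.aemeasurable
      hf.aestronglyMeasurable, hY.map_eq, ← integral_indicator_one hs, integral_prod_symm]
  · refine integral_congr_ae ?_
    filter_upwards [hJ0] with q hq
    rw [← gammaMeasure_real_Ioi n hq, ← integral_indicator_one measurableSet_Ioi]
    rfl
  · exact (integrable_indicator_iff hs).mpr (integrableOn_const (measure_ne_top _ _))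

section LaplaceTransform

variable {Ω : Type*} [MeasurableSpace Ω] {P : Measure Ω} [IsProbabilityMeasure P] {J : Ω → ℝ}

lemma mem_interior_integrableExpSet_neg (hJ : AEMeasurable J P) (hJ0 : ∀ᵐ ω ∂P, 0 ≤ J ω) {s : ℝ}
    (hs : 0 < s) : s ∈ interior (integrableExpSet (fun ω => -J ω) P) := by
  have hsub : Set.Ioi (0 : ℝ) ⊆ integrableExpSet (fun ω => -J ω) P := fun t ht => by
    have h := integrable_exp_neg_of_nonneg (hJ.const_mul t)
      (hJ0.mono fun ω hω => mul_nonneg (le_of_lt ht) hω)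
    simpa [integrableExpSet] using h
  exact interior_maximal hsub isOpen_Ioi hs

/-- The Laplace transform of `J` is the moment generating function of `-J`, which is analytic in the
interior of its domain. -/
lemma contDiffOn_of_eq_integral_exp_neg (hJ : AEMeasurable J P) (hJ0 : ∀ᵐ ω ∂P, 0 ≤ J ω)
    {L : ℝ → ℝ} (hL : ∀ s, 0 < s → L s = ∫ ω, Real.exp (-(s * J ω)) ∂P) :
    ContDiffOn ℝ (⊤ : ℕ∞) L (Set.Ioi 0) := by
  have h : ContDiffOn ℝ (⊤ : ℕ∞) (mgf (fun ω => -J ω) P) (Set.Ioi 0) :=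
    (analyticOnNhd_mgf.mono fun s hs =>
      mem_interior_integrableExpSet_neg hJ hJ0 hs).contDiffOn isOpen_Ioi.uniqueDiffOn
  refine h.congr fun s hs => ?_
  simp [hL s hs, mgf]

lemma iteratedDeriv_of_eq_integral_exp_neg (hJ : AEMeasurable J P) (hJ0 : ∀ᵐ ω ∂P, 0 ≤ J ω)
    {L : ℝ → ℝ} (hL : ∀ s, 0 < s → L s = ∫ ω, Real.exp (-(s * J ω)) ∂P) (n : ℕ) {s : ℝ}
    (hs : 0 < s) : iteratedDeriv n L s = ∫ ω, (-J ω) ^ n * Real.exp (-(s * J ω)) ∂P := by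
  have h : L =ᶠ[nhds s] mgf (fun ω => -J ω) P := by
    filter_upwards [Ioi_mem_nhds hs] with t ht
    simp [hL t ht, mgf]
  rw [h.iteratedDeriv_eq n, iteratedDeriv_mgf (mem_interior_integrableExpSet_neg hJ hJ0 hs)]
  simp

/-- If `G` has a Gamma distribution of integer shape and is independent of `J ≥ 0`, the tail of `G`
at `s J` is a combination of derivatives of the Laplace transform of `J`. -/
lemma measureReal_mul_lt_of_gammaMeasure {β : Type*} [MeasurableSpace β] {ν : Measure β}
    [IsProbabilityMeasure ν] {n : ℕ} {G : Ω → ℝ} {Y : Ω → β}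
    (hGY : MeasurePreserving (fun ω => (G ω, Y ω)) P ((gammaMeasure (n + 1 : ℕ) 1).prod ν))
    {I : β → ℝ} (hI : Measurable I) (hI0 : ∀ᵐ q ∂ν, 0 ≤ I q)
    {L : ℝ → ℝ} (hL : ∀ s, 0 < s → L s = ∫ ω, Real.exp (-(s * I (Y ω))) ∂P) {s : ℝ} (hs : 0 < s) :
    P.real {ω | s * I (Y ω) < G ω} =
      ∑ k ∈ Finset.range (n + 1), (-s) ^ k / k.factorial * iteratedDeriv k L s := by
  have hY : MeasurePreserving Y P ν := measurePreserving_snd.comp hGY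
  have hIY : AEMeasurable (fun ω => I (Y ω)) P := (hI.comp hY.measurable).aemeasurable
  have hIY0 : ∀ᵐ ω ∂P, 0 ≤ I (Y ω) := hY.quasiMeasurePreserving.ae hI0
  have hint : ∀ k : ℕ, Integrable (fun ω => (-I (Y ω)) ^ k * Real.exp (s * -I (Y ω))) P := fun k =>
    integrable_pow_mul_exp_of_mem_interior_integrableExpSet
      (mem_interior_integrableExpSet_neg hIY hIY0 hs) k
  rw [measureReal_lt_of_gammaMeasure hGY (J := fun q => s * I q) (hI.const_mul s)
    (hI0.mono fun q hq => mul_nonneg hs.le hq)]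
  have heq : ∀ (k : ℕ) (ω : Ω), (s * I (Y ω)) ^ k / k.factorial * Real.exp (-(s * I (Y ω))) =
      (-s) ^ k / k.factorial * ((-I (Y ω)) ^ k * Real.exp (s * -I (Y ω))) := fun k ω => by
    rw [show s * I (Y ω) = (-s) * (-I (Y ω)) by ring, mul_pow,
      show -(-s * -I (Y ω)) = s * -I (Y ω) by ring]
    ring
  simp_rw [heq]
  rw [integral_finsetSum _ fun k _ => (hint k).const_mul _]
  refine Finset.sum_congr rfl fun k _ => ?_
  rw [integral_const_mul, iteratedDeriv_of_eq_integral_exp_neg hIY hIY0 hL k hs]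
  simp only [mul_neg]

end LaplaceTransform

/-! ### The closed form without interference cancellation -/

/-- The product of the factors is the exponential of a sum over the points of the process, whose
mean is given by the Laplace functional. -/
lemma IsPoissonPointProcess.laplaceI_zero {Ω : Type*} [MeasurableSpace Ω] {P : Measure Ω}
    [IsProbabilityMeasure P] {ρ α lam : ℝ} {x : ℕ → Ω → Plane}
    (hΦ : IsPoissonPointProcess P x lam) (hlam : 0 ≤ lam) (hρ : 0 < ρ) (hα : 2 < α) {s : ℝ}
    (hs : 0 ≤ s) :
    laplaceI P ρ α x 0 s =
      Real.exp (-(2 * Real.pi ^ 2 * lam * ((s * ρ) ^ (2 / α) / α) *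
        (1 / Real.sin (2 * Real.pi / α)))) := by
  have hα0 : 0 < α := by linarith
  rcases hs.eq_or_lt with rfl | hs
  · have h0 : (0 : ℝ) ^ (2 / α) = 0 := Real.zero_rpow (by positivity)
    simp [laplaceI, laplaceFactor, h0]
  set a := s * ρ with ha_def
  have ha : 0 < a := mul_pos hs hρ
  set g : Plane → ℝ := fun y => Real.log (1 + a * ‖y‖ ^ (-α)) with hg_def
  have hg : Measurable g := by fun_prop
  have hpl : ∀ y : Plane, 0 ≤ a * ‖y‖ ^ (-α) := fun y => by positivity
  have hg0 : ∀ y, 0 ≤ g y := fun y => Real.log_nonneg (by linarith [hpl y])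
  have hint : Integrable fun y => min 1 (g y) := by
    refine (integrable_min_one_pathLoss hα ha.le).mono'
      (measurable_const.min hg).aestronglyMeasurable (Filter.Eventually.of_forall fun y => ?_)
    rw [Real.norm_of_nonneg (le_min zero_le_one (hg0 y))]
    refine min_le_min_left _ ?_
    have := Real.log_le_sub_one_of_pos (x := 1 + a * ‖y‖ ^ (-α)) (by linarith [hpl y])
    simp only [hg_def]
    linarith
  have hexp : ∀ y, Real.exp (-g y) = 1 / (1 + a * ‖y‖ ^ (-α)) := fun y => by
    rw [Real.exp_neg, Real.exp_log (by linarith [hpl y]), one_div]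
  have h1 : laplaceI P ρ α x 0 s = ∫ ω, Real.exp (-∑' i, g (x i ω)) ∂P := by
    refine integral_congr_ae ?_
    filter_upwards [hΦ.ae_summable hlam hg hg0 hint] with ω hω
    have hlog : ∀ i, -g (x i ω) = Real.log (laplaceFactor ρ α (fun i => x i ω) 0 s i) := fun i => by
      simp only [laplaceFactor, zero_add, hg_def, one_div, Real.log_inv]
      rfl
    have hpos : ∀ i, 0 < laplaceFactor ρ α (fun i => x i ω) 0 s i := fun i => by
      have := hpl (x (0 + i) ω)
      simp only [laplaceFactor]
      positivity
    rw [← tsum_neg]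
    simp_rw [hlog]
    exact (Real.rexp_tsum_eq_tprod hpos (hω.neg.congr hlog)).symm
  rw [h1, hΦ.integral_exp_neg_tsum hlam hg hg0 hint]
  simp_rw [hexp]
  rw [integral_pathLoss hα ha]
  congr 1
  ring

/-! ### The success probability -/

theorem theorem1 {Ω : Type*} [MeasurableSpace Ω] (P : Measure Ω) [IsProbabilityMeasure P]
    (N : ℕ) (ρ₀ ρ α lam : ℝ) (hρ₀ : 0 < ρ₀) (hρ : 0 < ρ) (hα : 2 < α) (hlam : 0 < lam)
    (x₀ : Plane) (hx₀ : x₀ ≠ 0)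
    (x : ℕ → Ω → Plane) (h : ℕ → Ω → EuclideanSpace ℂ (Fin N))
    -- the interferers: a Poisson point process, indexed by increasing distance to the origin
    (hΦ : IsPoissonPointProcess P x lam)
    (hmono : ∀ᵐ ω ∂P, Monotone fun i => ‖x i ω‖)
    -- the channels: i.i.d. Rayleigh fading, independent of the locations
    (hmeas : ∀ j, Measurable (h j))
    (hlaw : ∀ j, P.map (h j) = stdComplexGaussianVec N)
    (hindep : iIndepFun h P)
    (hxh : IndepFun (fun ω i => x i ω) (fun ω j => h j ω) P) :
    -- for every number `M ≤ N - 1` of cancelled interferers: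
    (∀ M : ℕ, M < N →
      -- the interference is a convergent series with positive sum
      (∀ᵐ ω ∂P,
        Summable (interferenceTerm ρ α (fun i => x i ω) (fun j => h j ω) M) ∧
        0 < interference ρ α (fun i => x i ω) (fun j => h j ω) M) ∧
      -- the function `laplaceI` is well defined and is the Laplace transform of the interference
      (∀ s : ℝ, 0 ≤ s →
        (∀ᵐ ω ∂P, Multipliable (laplaceFactor ρ α (fun i => x i ω) M s)) ∧
        Integrable (fun ω => ∏' k : ℕ, laplaceFactor ρ α (fun i => x i ω) M s k) P ∧
        laplaceI P ρ α x M s =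
          ∫ ω, Real.exp (-s * interference ρ α (fun i => x i ω) (fun j => h j ω) M) ∂P) ∧
      ContDiffOn ℝ (⊤ : ℕ∞) (laplaceI P ρ α x M) (Set.Ioi 0) ∧
      -- the success probability
      (∀ θ : ℝ, 0 < θ →
        successProb P ρ₀ ρ α x₀ x h θ M =
          ∑ n ∈ Finset.range (N - M),
            (-(θ * ρ₀⁻¹ * ‖x₀‖ ^ α)) ^ n / (n.factorial : ℝ) *
              iteratedDeriv n (laplaceI P ρ α x M) (θ * ρ₀⁻¹ * ‖x₀‖ ^ α))) ∧
    -- the closed form for `M = 0`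
    (∀ s : ℝ, 0 ≤ s →
      laplaceI P ρ α x 0 s =
        Real.exp (-(2 * Real.pi ^ 2 * lam * ((s * ρ) ^ (2 / α) / α) *
          (1 / Real.sin (2 * Real.pi / α))))) := by
  refine ⟨fun M hM => ?_, fun s hs => hΦ.laplaceI_zero hlam.le hρ hα hs⟩
  obtain ⟨n, hn⟩ : ∃ n, M + (n + 1) = N := ⟨N - M - 1, by omega⟩
  have hxm : Measurable fun ω i => x i ω := measurable_pi_lambda _ hΦ.measurable
  have hsum := hΦ.ae_summable_pathLoss hlam.le hα
  set μ := P.map fun ω i => x i ω with hμ_def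
  have : IsProbabilityMeasure μ := Measure.isProbabilityMeasure_map hxm.aemeasurable
  have hμ : ∀ᵐ y ∂μ, Summable fun i => ‖y i‖ ^ (-α) :=
    (ae_map_iff hxm.aemeasurable (measurableSet_setOf_summable fun k => by fun_prop)).mpr hsum
  have hμ0 : ∀ᵐ y ∂μ, ∀ i, y i ≠ 0 := by
    refine ae_all_iff.mpr fun i => ?_
    exact (ae_map_iff hxm.aemeasurable
      ((measurable_pi_apply i) (measurableSet_singleton (0 : Plane)).compl)).mpr
        ((hΦ.ae_ne_zero hlam.le).mono fun ω hω => hω i)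
  set E := Measure.infinitePi fun _ : ℕ => expMeasure 1 with hE_def
  set Y : Ω → (ℕ → Plane) × (ℕ → ℝ) := fun ω =>
    ((fun i => x i ω), fun k => gain (fun j => h j ω) M (M + k + 1)) with hY_def
  have hGY : MeasurePreserving (fun ω => (gain (fun j => h j ω) M 0, Y ω)) P
      ((gammaMeasure (n + 1 : ℕ) 1).prod (μ.prod E)) :=
    measurePreserving_gain_zero_locations_gains hΦ.measurable hmeas hlaw hindep hxh hn
  have hY : MeasurePreserving Y P (μ.prod E) := measurePreserving_snd.comp hGY
  have hI : ∀ ω, interference ρ α (fun i => x i ω) (fun j => h j ω) M =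
      interferenceSeries ρ α M (Y ω) := fun ω => rfl
  have hIm := measurable_interferenceSeries ρ α M
  have hae := ae_interferenceSeries hρ hμ hμ0 M
  have hI0 : ∀ᵐ q ∂(μ.prod E), 0 ≤ interferenceSeries ρ α M q := hae.mono fun q hq => hq.2.le
  have haeP := hY.quasiMeasurePreserving.ae hae
  have hL : ∀ s, 0 ≤ s → laplaceI P ρ α x M s =
      ∫ ω, Real.exp (-(s * interferenceSeries ρ α M (Y ω))) ∂P := fun s hs => by
    rw [← integral_map (f := fun q => Real.exp (-(s * interferenceSeries ρ α M q)))
      hY.measurable.aemeasurable (hIm.const_mul s).neg.exp.aestronglyMeasurable, hY.map_eq,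
      integral_exp_neg_interferenceSeries hρ hμ hμ0 M hs, hμ_def,
      integral_map hxm.aemeasurable
        (measurable_tprod_laplaceFactor ρ α M s).aestronglyMeasurable]
    rfl
  have hIYm : AEMeasurable (fun ω => interferenceSeries ρ α M (Y ω)) P :=
    (hIm.comp hY.measurable).aemeasurable
  refine ⟨haeP, fun s hs => ⟨?_, ?_, ?_⟩, ?_, fun θ hθ => ?_⟩
  · filter_upwards [hsum] with ω hω
    exact multipliable_one_div_one_add (fun k => pathLoss_nonneg hρ hs _)
      (summable_pathLoss_add hω M (s * ρ))
  · refine Integrable.of_bound ((measurable_tprod_laplaceFactor ρ α M s).comp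
      hxm).aestronglyMeasurable 1 ?_
    filter_upwards [hsum] with ω hω
    have h01 := tprod_one_div_one_add_mem_Icc (fun k => pathLoss_nonneg hρ hs (x (M + k) ω))
      (summable_pathLoss_add hω M (s * ρ))
    exact (Real.norm_of_nonneg h01.1).trans_le h01.2
  · simp_rw [hI, neg_mul]
    exact hL s hs
  · exact contDiffOn_of_eq_integral_exp_neg hIYm (haeP.mono fun ω hω => hω.2.le)
      fun s hs => hL s hs.le
  · have hR : 0 < ‖x₀‖ := norm_pos_iff.mpr hx₀
    have hs : 0 < θ * ρ₀⁻¹ * ‖x₀‖ ^ α := by positivity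
    rw [show N - M = n + 1 by omega,
      ← measureReal_mul_lt_of_gammaMeasure hGY hIm hI0 (fun s hs => hL s hs.le) hs]
    refine measureReal_congr ?_
    filter_upwards [haeP] with ω hω
    have hpos : 0 < interference ρ α (fun i => x i ω) (fun j => h j ω) M := hω.2
    have hRα : 0 < ‖x₀‖ ^ α := Real.rpow_pos_of_pos hR _
    refine propext ?_
    change θ < sir ρ₀ ρ α x₀ (fun i => x i ω) (fun j => h j ω) M ↔
      θ * ρ₀⁻¹ * ‖x₀‖ ^ α * interference ρ α (fun i => x i ω) (fun j => h j ω) M <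
        gain (fun j => h j ω) M 0
    -- `SIR > θ` means that the gain of the transmitter exceeds `s I` with `s = θ ρ₀⁻¹ ‖x₀‖ ^ α`.
    rw [sir, lt_div_iff₀ hpos, Real.rpow_neg hR.le]
    have hfac : 0 < ρ₀⁻¹ * ‖x₀‖ ^ α := by positivity
    rw [← mul_lt_mul_iff_right₀ hfac]
    have e1 : ρ₀⁻¹ * ‖x₀‖ ^ α * (ρ₀ * (‖x₀‖ ^ α)⁻¹ * gain (fun j => h j ω) M 0) =
        gain (fun j => h j ω) M 0 := by field_simp
    rw [e1]
    ring_nf
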